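/- **Conventions.** For a probability measure $\mu$ on $\mathbb{C}$ all of whose moments are finite (i.e. $z\mapsto z^n$ is $\mu$-integrable for all $n$), put $m_n(\mu)=\int z^n\,\mu(dz)$; measures on the real line or on the unit circle are special cases. Let $NC(n)$ be the set of non-crossing partitions of $[n]=\{1,\dots,n\}$. For a sequence $(u_j)_{j\ge 1}$ and a partition $\pi$ put $u_\pi=\prod_{V\in\pi}u_{|V|}$. The free cumulants $\kappa_n(\mu)$, $n\ge1$, are defined recursively by $m_n(\mu)=\sum_{\pi\in NC(n)}\kappa_\pi(\mu)$. The Kreweras complement $Kr(\pi)$ of $\pi\in NC(n)$ is the partition of $[n]$ into the cycles of $\alpha_\pi^{-1}\gamma_n$, where $\gamma_n=(1,2,\dots,n)$ and $\alpha_\pi$ is the permutation whose cycles are the blocks of $\pi$ in increasing order. The free multiplicative convolution $\mu\boxtimes\nu$ is given by its free cumulants $$\kappa_n(\mu\boxtimes\nu)=\sum_{\pi\in NC(n)}\kappa_\pi(\mu)\,\kappa_{Kr(\pi)}(\nu),\qquad n\ge1,$$ and its moments are $m_n(\mu\boxtimes\nu)=\sum_{\pi\in NC(n)}\kappa_\pi(\mu\boxtimes\nu)$.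 (For general $\mu,\nu$ this is a sequence of numbers, whether or not it is the moment sequence of a measure.) For a monic $p\in\mathbb{C}[x]$ of degree $d\ge1$ with roots $\lambda_1,\dots,\lambda_d$ (with multiplicity) put $m_n(p)=\frac1d\sum_{i=1}^d\lambda_i^n$ and write $p(x)=\sum_{k=0}^d(-1)^k a_k^p x^{d-k}$. The finite free multiplicative convolution of two such polynomials is $$(p\boxtimes_d q)(x)=\sum_{k=0}^d(-1)^k\,\frac{a_k^p a_k^q}{\binom dk}\,x^{d-k}.$$ **Proposition (convergence in moments).** Let $\mu$ and $\nu$ be probability measures on $\mathbb{C}$ with all moments finite. For each $d\ge1$ let $p_d,q_d\in\mathbb{C}[x]$ be monic of degree $d$ (not necessarily real-rooted). Suppose that for every $n\ge1$ $$\lim_{d\to\infty}m_n(p_d)=m_n(\mu)\quad\text{and}\quad\lim_{d\to\infty}m_n(q_d)=m_n(\nu).$$ Then for every $n\ge1$ $$\lim_{d\to\infty}m_n(p_d\boxtimes_d q_d)=m_n(\mu\boxtimes\nu)=\sum_{\pi\in NC(n)}\kappa_\pi(\mu)\,m_{Kr(\pi)}(\nu).$$ In particular, if $\rho$ is any probability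 measure on $\mathbb{C}$ with all moments finite and with free cumulants $\kappa_n(\rho)=\sum_{\pi\in NC(n)}\kappa_\pi(\mu)\kappa_{Kr(\pi)}(\nu)$ for all $n\ge1$, then $\lim_{d\to\infty}m_n(p_d\boxtimes_d q_d)=m_n(\rho)$ for every $n\ge1$. -/

import Mathlib

open MeasureTheory Filter Topology Polynomial

namespace FreeProb

/-! ### Set partitions, non-crossing partitions, Kreweras complement -/

/-- The set partitions of an `n`-element totally ordered set, here `Fin n = {0, …, n - 1}`. -/
abbrev SetPartition (n : ℕ) : Type := Finpartition (Finset.univ : Finset (Fin n))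

/-- `π` is non-crossing: if `i < j < k < l`, with `i, k` in a block `V` and `j, l` in a block `W`,
then `V = W`. -/
def IsNonCrossing {n : ℕ} (π : SetPartition n) : Prop :=
  ∀ i j k l : Fin n, i < j → j < k → k < l →
    ∀ V ∈ π.parts, ∀ W ∈ π.parts, i ∈ V → k ∈ V → j ∈ W → l ∈ W → V = W

open Classical in
/-- The set `NC(n)` of non-crossing partitions. -/
noncomputable def NC (n : ℕ) : Finset (SetPartition n) :=
  Finset.univ.filter IsNonCrossing

/-- `u_π = ∏_{V ∈ π} u_{|V|}`. -/
noncomputable def blockProd (u : ℕ → ℂ) {n : ℕ} (π : SetPartition n) : ℂ :=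
  ∏ V ∈ π.parts, u V.card

/-- The permutation whose cycles are the blocks of `π`, each traversed in increasing order:
on a block `V = {v₀ < v₁ < … < v_{k-1}}` it is the cycle `v₀ ↦ v₁ ↦ … ↦ v_{k-1} ↦ v₀`. -/
noncomputable def blockPerm {n : ℕ} (π : SetPartition n) : Equiv.Perm (Fin n) :=
  (Equiv.subtypeUnivEquiv fun i : Fin n => Finset.mem_univ i).permCongr
    (π.equivSigmaParts.symm.permCongr
      (Equiv.sigmaCongrRight fun V : π.parts =>
        (V.1.orderIsoOfFin rfl).toEquiv.permCongr (finRotate V.1.card)))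

open Classical in
/-- The partition of `Fin n` into the cycles (fixed points included) of a permutation. -/
noncomputable def cyclePartition {n : ℕ} (α : Equiv.Perm (Fin n)) : SetPartition n :=
  Finpartition.ofSetoid (Equiv.Perm.SameCycle.setoid α)

/-- The Kreweras complement: the cycles of `α⁻¹ γ`, where `α` is the permutation attached to `π`
and `γ` is the long cycle `i ↦ i + 1`. -/
noncomputable def kreweras {n : ℕ} (π : SetPartition n) : SetPartition n :=
  cyclePartition ((blockPerm π)⁻¹ * finRotate n)

theorem blockPerm_apply {n : ℕ} (π : SetPartition n) {V : Finset (Fin n)} (hV : V ∈ π.parts)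
    (k : Fin V.card) :
    blockPerm π (V.orderEmbOfFin rfl k) = V.orderEmbOfFin rfl (finRotate V.card k) := by
  have key : π.equivSigmaParts ⟨V.orderEmbOfFin rfl k, Finset.mem_univ _⟩ =
      ⟨⟨V, hV⟩, V.orderIsoOfFin rfl k⟩ := by
    rw [← Equiv.eq_symm_apply]
    rfl
  simp only [blockPerm, Equiv.permCongr_apply, Equiv.subtypeUnivEquiv_symm_apply, Equiv.symm_symm]
  rw [key]
  simp only [Equiv.sigmaCongrRight_apply, Equiv.permCongr_apply]
  have h2 : (V.orderIsoOfFin rfl).toEquiv.symm (V.orderIsoOfFin rfl k) = k :=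
    (V.orderIsoOfFin rfl).toEquiv.symm_apply_apply k
  rw [h2]
  rfl

/-! ### Free cumulants and the free multiplicative convolution -/

/-- The free cumulants of a moment sequence `m`, by the recursion
`κ_n = m_n - ∑_{π ∈ NC(n), π ≠ 1_n} κ_π` that solves the moment-cumulant formula. All the blocks of
`π ≠ 1_n` have fewer than `n` elements, so that the `else` branch is never used. -/
noncomputable def freeCumulant (m : ℕ → ℂ) (n : ℕ) : ℂ :=
  m n - ∑ π ∈ (NC n).filter (fun π => Finset.univ ∉ π.parts),
    ∏ V ∈ π.parts, if _h : V.card < n then freeCumulant m V.card else 0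
termination_by n

/-- The moment-cumulant formula `m_n = ∑_{π ∈ NC(n)} κ_π`. -/
theorem moment_eq_sum_freeCumulant (m : ℕ → ℂ) {n : ℕ} (hn : 1 ≤ n) :
    m n = ∑ π ∈ NC n, blockProd (freeCumulant m) π := by
  have hne : (Finset.univ : Finset (Fin n)) ≠ ⊥ := by
    have : Nonempty (Fin n) := ⟨⟨0, hn⟩⟩
    exact Finset.univ_nonempty.ne_empty
  have huniq : ∀ π : SetPartition n, Finset.univ ∈ π.parts →
      π = Finpartition.indiscrete hne := by
    intro π hπ
    ext W
    rw [Finpartition.indiscrete_parts, Finset.mem_singleton]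
    constructor
    · intro hW
      obtain ⟨x, hx⟩ := π.nonempty_of_mem_parts hW
      exact π.eq_of_mem_parts hW hπ hx (Finset.mem_univ x)
    · rintro rfl
      exact hπ
  have hmem : Finpartition.indiscrete hne ∈ NC n := by
    classical
    rw [NC, Finset.mem_filter]
    refine ⟨Finset.mem_univ _, ?_⟩
    intro i j k l _ _ _ V hV W hW _ _ _ _
    rw [Finpartition.indiscrete_parts, Finset.mem_singleton] at hV hW
    rw [hV, hW]
  have hfilter : (NC n).filter (fun π => ¬ Finset.univ ∉ π.parts) =
      {Finpartition.indiscrete hne} := by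
    ext π
    simp only [Finset.mem_filter, not_not, Finset.mem_singleton]
    constructor
    · rintro ⟨_, h⟩
      exact huniq π h
    · rintro rfl
      exact ⟨hmem, by simp⟩
  rw [← Finset.sum_filter_add_sum_filter_not (NC n) (fun π => Finset.univ ∉ π.parts), hfilter,
    Finset.sum_singleton]
  have h1 : blockProd (freeCumulant m) (Finpartition.indiscrete hne) = freeCumulant m n := by
    simp [blockProd]
  have h2 : ∑ π ∈ (NC n).filter (fun π => Finset.univ ∉ π.parts), blockProd (freeCumulant m) π =
      ∑ π ∈ (NC n).filter (fun π => Finset.univ ∉ π.parts),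
        ∏ V ∈ π.parts, if _h : V.card < n then freeCumulant m V.card else 0 := by
    refine Finset.sum_congr rfl fun π hπ => Finset.prod_congr rfl fun V hV => ?_
    have hV' : V ≠ Finset.univ := by
      rintro rfl
      exact (Finset.mem_filter.mp hπ).2 hV
    have hlt : V.card < n := by
      have := Finset.card_lt_univ_of_notMem
        (Classical.not_forall.mp fun h => hV' (Finset.eq_univ_iff_forall.mpr h)).choose_spec
      simpa using this
    rw [dif_pos hlt]
  rw [h1, h2, freeCumulant]
  ring

/-- The free cumulants of the free multiplicative convolution:
`∑_{π ∈ NC(n)} κ_π(a) κ_{Kr(π)}(b)`, where `a` and `b` are the moment sequences of the factors. -/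
noncomputable def freeMulCumulant (a b : ℕ → ℂ) (n : ℕ) : ℂ :=
  ∑ π ∈ NC n, blockProd (freeCumulant a) π * blockProd (freeCumulant b) (kreweras π)

/-- The moments of the free multiplicative convolution: those given by the moment-cumulant formula
from the free cumulants `freeMulCumulant a b`. -/
noncomputable def freeMulMoment (a b : ℕ → ℂ) (n : ℕ) : ℂ :=
  ∑ π ∈ NC n, blockProd (freeMulCumulant a b) π

/-- The `n`-th moment `∫ z ^ n dμ` of a measure on the complex plane. -/
noncomputable def measureMoment (μ : Measure ℂ) (n : ℕ) : ℂ := ∫ z, z ^ n ∂μ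

/-- All moments of `μ` are finite. -/
def HasFiniteMoments (μ : Measure ℂ) : Prop := ∀ n : ℕ, Integrable (fun z : ℂ => z ^ n) μ

/-- The probability measure `ρ` with finite moments is a free multiplicative convolution of `μ`
and `ν`: its free cumulants are `κ_n(ρ) = ∑_{π ∈ NC(n)} κ_π(μ) κ_{Kr(π)}(ν)`. -/
structure IsFreeMulConv (μ ν ρ : Measure ℂ) : Prop where
  isProbabilityMeasure : IsProbabilityMeasure ρ
  hasFiniteMoments : HasFiniteMoments ρ
  cumulant_eq : ∀ n : ℕ, 1 ≤ n →
    freeCumulant (measureMoment ρ) n = freeMulCumulant (measureMoment μ) (measureMoment ν) n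

/-! ### Polynomials -/

/-- The signed coefficients `a_k`, `k ≤ d`, with `p(x) = ∑_{k ≤ d} (-1)^k a_k x^{d-k}`. -/
noncomputable def signedCoeff (d : ℕ) (p : ℂ[X]) (k : ℕ) : ℂ := (-1) ^ k * p.coeff (d - k)

/-- The finite free multiplicative convolution
`p ⊠_d q = ∑_{k ≤ d} (-1)^k (a_k(p) a_k(q) / binom(d, k)) x^{d-k}`. -/
noncomputable def finiteFreeMul (d : ℕ) (p q : ℂ[X]) : ℂ[X] :=
  ∑ k ∈ Finset.range (d + 1),
    C ((-1) ^ k * (signedCoeff d p k * signedCoeff d q k / (d.choose k : ℂ))) * X ^ (d - k)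

/-- The `n`-th moment `(1/d) ∑_i λ_i ^ n` of a polynomial of degree `d` with roots `λ_1, …, λ_d`
(with multiplicity). -/
noncomputable def rootMoment (p : ℂ[X]) (n : ℕ) : ℂ :=
  (p.roots.map fun z => z ^ n).sum / (p.natDegree : ℂ)

end FreeProb

open FreeProb

namespace FreeProb

/-! Attach to `p` of degree `d` the series U = ∏(1 - λz) over its roots. The coefficients of
U'/(-dU) are the moments of `p`. Rescaling the coefficients of U by d^k/(binom(d,k) k!) gives
`cumulantSeries`. With D = -d, the product `hadamard D`, whose weights are k! D^(-k), turns the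
cumulant series of `p` and the root series of `q` into the root series of p ⊠_d q, and turns two
cumulant series into the cumulant series of p ⊠_d q. Everything thus reduces to one question: how do
the coefficients of D⁻¹ (log W)' behave for W = `hadamard D U V` when D⁻¹ → 0 and those of D⁻¹ (log
U)' and D⁻¹ (log V)' converge to f and g?

The weights make multiplication by z in one argument adjoint to D⁻¹ d/dz in the other, up to a
factor z. Since D⁻¹(AU)' = A (U'/(DU)) U + D⁻¹A'U, the normalised pairing of z^i and z^j obeys a
recursion whose only non-multiplicative term carries D⁻¹. In the limit the pairing factorises as x^i
y^j, where x = z g(y) and y = z f(x) (`tendsto_coeff_pairing`), and z D⁻¹ (log W)' tends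
coefficientwise to x f(x).

The same system counts non-crossing partitions. Cutting a partition at the second point of the class
of its first point gives `ncWeight_succ`, and deleting a singleton gives `singletonWeight_succ`. The
resulting functional equations (`exists_isTreeSystem`) identify the coefficients of x f(x) with the
sums of u_π v_{Kr(π)}.

Three uses finish the proof. The polynomial (x - 1)^d is the unit of ⊠_d and has all moments 1.
Pairing with it links finite cumulants to moments by a triangular relation, which can be inverted,
so convergence of moments gives convergence of finite cumulants to free cumulants. Pairing two
cumulant series gives the limiting cumulants of p ⊠_d q, and pairing again with the unit gives its
moments. Pairing the cumulants of `p` with the moments of `q` gives the same limit in its second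
form. -/

/-! ### A weighted Hadamard product of power series -/

/-- The bilinear product `∑ k, k! D⁻ᵏ [A]_k [B]_k zᵏ`. -/
noncomputable def hadamard (D : ℂ) (A B : PowerSeries ℂ) : PowerSeries ℂ :=
  PowerSeries.mk fun k =>
    (k.factorial : ℂ) * D⁻¹ ^ k * (PowerSeries.coeff k A * PowerSeries.coeff k B)

theorem coeff_hadamard (D : ℂ) (A B : PowerSeries ℂ) (k : ℕ) :
    PowerSeries.coeff k (hadamard D A B) =
      (k.factorial : ℂ) * D⁻¹ ^ k * (PowerSeries.coeff k A * PowerSeries.coeff k B) := by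
  rw [hadamard, PowerSeries.coeff_mk]

theorem hadamard_comm (D : ℂ) (A B : PowerSeries ℂ) : hadamard D A B = hadamard D B A := by
  ext k
  rw [coeff_hadamard, coeff_hadamard, mul_comm (PowerSeries.coeff k A)]

theorem hadamard_add_left (D : ℂ) (A A' B : PowerSeries ℂ) :
    hadamard D (A + A') B = hadamard D A B + hadamard D A' B := by
  ext k
  simp only [coeff_hadamard, map_add]
  ring

theorem hadamard_C_mul_left (D c : ℂ) (A B : PowerSeries ℂ) :
    hadamard D (PowerSeries.C c * A) B = PowerSeries.C c * hadamard D A B := by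
  ext k
  simp only [coeff_hadamard, PowerSeries.coeff_C_mul]
  ring

/-- The ratio of consecutive weights is (k + 1) D⁻¹, and k + 1 is the factor produced by
differentiation. This adjointness is what drives the recursions for the pairing. -/
theorem hadamard_X_mul_right (D : ℂ) (A B : PowerSeries ℂ) :
    hadamard D A (PowerSeries.X * B) =
      PowerSeries.X * (PowerSeries.C D⁻¹ * hadamard D (PowerSeries.derivative ℂ A) B) := by
  ext k
  cases k with
  | zero => simp [coeff_hadamard]
  | succ k =>
    rw [coeff_hadamard, PowerSeries.coeff_succ_X_mul, PowerSeries.coeff_succ_X_mul,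
      PowerSeries.coeff_C_mul, coeff_hadamard, PowerSeries.coeff_derivative, Nat.factorial_succ]
    push_cast
    ring

theorem coeff_hadamard_X_pow_mul_left (D : ℂ) (A B : PowerSeries ℂ) {k n : ℕ} (h : k < n) :
    PowerSeries.coeff k (hadamard D (PowerSeries.X ^ n * A) B) = 0 := by
  rw [coeff_hadamard, PowerSeries.coeff_X_pow_mul', if_neg (not_le.mpr h)]
  ring

/-! ### Scaled logarithmic derivatives and the normalised pairing -/

/-- The scaled logarithmic derivative `U' / (D U)`. -/
noncomputable def scaledLogDeriv (D : ℂ) (U : PowerSeries ℂ) : PowerSeries ℂ :=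
  PowerSeries.C D⁻¹ * PowerSeries.derivative ℂ U * U⁻¹

theorem derivative_eq_scaledLogDeriv {D : ℂ} (hD : D ≠ 0) {U : PowerSeries ℂ}
    (hU : PowerSeries.constantCoeff U = 1) :
    PowerSeries.derivative ℂ U = PowerSeries.C D * scaledLogDeriv D U * U := by
  have h1 : U⁻¹ * U = 1 := PowerSeries.inv_mul_cancel U (by simp [hU])
  have h2 : PowerSeries.C D * PowerSeries.C D⁻¹ = (1 : PowerSeries ℂ) := by
    rw [← map_mul, mul_inv_cancel₀ hD, map_one]
  calc PowerSeries.derivative ℂ U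
      = (PowerSeries.C D * PowerSeries.C D⁻¹) * PowerSeries.derivative ℂ U * (U⁻¹ * U) := by
        rw [h1, h2]; ring
    _ = _ := by rw [scaledLogDeriv]; ring

theorem scaledLogDeriv_eq_of_derivative_eq {D : ℂ} (hD : D ≠ 0) {U f : PowerSeries ℂ}
    (hU : PowerSeries.constantCoeff U = 1)
    (h : PowerSeries.derivative ℂ U = PowerSeries.C D * f * U) : scaledLogDeriv D U = f := by
  have h1 : U * U⁻¹ = 1 := PowerSeries.mul_inv_cancel U (by simp [hU])
  have h2 : PowerSeries.C D⁻¹ * PowerSeries.C D = (1 : PowerSeries ℂ) := by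
    rw [← map_mul, inv_mul_cancel₀ hD, map_one]
  calc scaledLogDeriv D U
      = (PowerSeries.C D⁻¹ * PowerSeries.C D) * f * (U * U⁻¹) := by
        rw [scaledLogDeriv, h]; ring
    _ = f := by rw [h1, h2]; ring

/-- The normalised pairing of `A` and `B` in the state given by `U` and `V`. -/
noncomputable def pairing (D : ℂ) (U V A B : PowerSeries ℂ) : PowerSeries ℂ :=
  hadamard D (A * U) (B * V) * (hadamard D U V)⁻¹

theorem constantCoeff_hadamard {D : ℂ} {U V : PowerSeries ℂ}
    (hU : PowerSeries.constantCoeff U = 1) (hV : PowerSeries.constantCoeff V = 1) :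
    PowerSeries.constantCoeff (hadamard D U V) = 1 := by
  rw [← PowerSeries.coeff_zero_eq_constantCoeff_apply, coeff_hadamard]
  simp [hU, hV]

theorem pairing_comm (D : ℂ) (U V A B : PowerSeries ℂ) :
    pairing D U V A B = pairing D V U B A := by
  rw [pairing, pairing, hadamard_comm D U, hadamard_comm D (A * U)]

theorem pairing_one_one {D : ℂ} {U V : PowerSeries ℂ}
    (hU : PowerSeries.constantCoeff U = 1) (hV : PowerSeries.constantCoeff V = 1) :
    pairing D U V 1 1 = 1 := by
  rw [pairing, one_mul, one_mul]
  exact PowerSeries.mul_inv_cancel _ (by simp [constantCoeff_hadamard hU hV])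

theorem pairing_add_left (D : ℂ) (U V A A' B : PowerSeries ℂ) :
    pairing D U V (A + A') B = pairing D U V A B + pairing D U V A' B := by
  rw [pairing, add_mul, hadamard_add_left, add_mul]; rfl

theorem pairing_C_mul_left (D c : ℂ) (U V A B : PowerSeries ℂ) :
    pairing D U V (PowerSeries.C c * A) B = PowerSeries.C c * pairing D U V A B := by
  rw [pairing, mul_assoc, hadamard_C_mul_left, mul_assoc]; rfl

theorem coeff_pairing_X_pow_mul_left (D : ℂ) (U V A B : PowerSeries ℂ) {k n : ℕ} (h : k < n) :
    PowerSeries.coeff k (pairing D U V (PowerSeries.X ^ n * A) B) = 0 := by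
  rw [pairing, PowerSeries.coeff_mul]
  refine Finset.sum_eq_zero fun x hx => ?_
  have := Finset.HasAntidiagonal.mem_antidiagonal.mp hx
  rw [mul_assoc, coeff_hadamard_X_pow_mul_left D _ _ (by omega), zero_mul]

/-- Extends linearity in the left argument to the infinite expansion of `f`, one coefficient at a
time. -/
theorem coeff_pairing_mul_left (D : ℂ) (U V A B f : PowerSeries ℂ) (n : ℕ) :
    PowerSeries.coeff n (pairing D U V (A * f) B) =
      ∑ m ∈ Finset.range (n + 1), PowerSeries.coeff m f *
        PowerSeries.coeff n (pairing D U V (A * PowerSeries.X ^ m) B) := by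
  have hsum : ∀ N : ℕ, pairing D U V (A * ((PowerSeries.trunc N f : ℂ[X]) : PowerSeries ℂ)) B =
      ∑ m ∈ Finset.range N, PowerSeries.C (PowerSeries.coeff m f) *
        pairing D U V (A * PowerSeries.X ^ m) B := by
    intro N
    induction N with
    | zero => simp [pairing, hadamard]; left; ext; simp
    | succ N ih =>
      rw [PowerSeries.trunc_succ, Polynomial.coe_add, mul_add, pairing_add_left, ih,
        Finset.sum_range_succ, Polynomial.coe_monomial, ← pairing_C_mul_left,
        PowerSeries.monomial_eq_mk]
      congr 2
      rw [PowerSeries.X_pow_eq, mul_left_comm]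
      congr 1
      ext; simp [PowerSeries.coeff_monomial]
  -- The tail of `f` beyond order n carries a factor z^(n+1) and cannot reach the coefficient of
  -- order n.
  have h : A * f = A * ((PowerSeries.trunc (n + 1) f : ℂ[X]) : PowerSeries ℂ) +
      PowerSeries.X ^ (n + 1) *
        (A * PowerSeries.mk fun i => PowerSeries.coeff (i + (n + 1)) f) := by
    conv_lhs => rw [PowerSeries.eq_X_pow_mul_shift_add_trunc (n + 1) f]
    ring
  rw [h, pairing_add_left, hsum, map_add,
    coeff_pairing_X_pow_mul_left D U V _ B (Nat.lt_succ_self n), add_zero, map_sum]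
  simp only [PowerSeries.coeff_C_mul]

/-- Adjointness combined with the Leibniz rule for AU. For large D, a factor z on the right acts
like z times the scaled logarithmic derivative of `U` on the left, with an error of size D⁻¹. -/
theorem pairing_X_mul_right {D : ℂ} (hD : D ≠ 0) {U : PowerSeries ℂ} (V A B : PowerSeries ℂ)
    (hU : PowerSeries.constantCoeff U = 1) :
    pairing D U V A (PowerSeries.X * B) =
      PowerSeries.X * (pairing D U V (A * scaledLogDeriv D U) B +
        PowerSeries.C D⁻¹ * pairing D U V (PowerSeries.derivative ℂ A) B) := by
  have h2 : PowerSeries.C D⁻¹ * PowerSeries.C D = (1 : PowerSeries ℂ) := by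
    rw [← map_mul, inv_mul_cancel₀ hD, map_one]
  have h1 : PowerSeries.derivative ℂ (A * U) =
      PowerSeries.C D * (A * scaledLogDeriv D U * U) + PowerSeries.derivative ℂ A * U := by
    rw [Derivation.leibniz, smul_eq_mul, smul_eq_mul, derivative_eq_scaledLogDeriv hD hU]
    ring
  rw [pairing, mul_assoc PowerSeries.X, hadamard_X_mul_right, h1, hadamard_add_left,
    hadamard_C_mul_left, mul_add, ← mul_assoc (PowerSeries.C D⁻¹), h2, pairing, pairing]
  ring

theorem coeff_pairing_X_pow_succ_right {D : ℂ} (hD : D ≠ 0) {U : PowerSeries ℂ}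
    (V : PowerSeries ℂ) (hU : PowerSeries.constantCoeff U = 1) (n i j : ℕ) :
    PowerSeries.coeff (n + 1) (pairing D U V (PowerSeries.X ^ i) (PowerSeries.X ^ (j + 1))) =
      ∑ m ∈ Finset.range (n + 1), PowerSeries.coeff m (scaledLogDeriv D U) *
        PowerSeries.coeff n (pairing D U V (PowerSeries.X ^ (i + m)) (PowerSeries.X ^ j)) +
      D⁻¹ * (i * PowerSeries.coeff n
        (pairing D U V (PowerSeries.X ^ (i - 1)) (PowerSeries.X ^ j))) := by
  have h : PowerSeries.derivative ℂ (PowerSeries.X ^ i : PowerSeries ℂ) =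
      PowerSeries.C (i : ℂ) * PowerSeries.X ^ (i - 1) := by
    rw [PowerSeries.derivative_pow, PowerSeries.derivative_X]
    simp
  rw [pow_succ', pairing_X_mul_right hD V _ _ hU, PowerSeries.coeff_succ_X_mul, map_add,
    coeff_pairing_mul_left, PowerSeries.coeff_C_mul, h, pairing_C_mul_left,
    PowerSeries.coeff_C_mul]
  simp only [pow_add]

theorem coeff_pairing_X_pow_succ_left {D : ℂ} (hD : D ≠ 0) (U : PowerSeries ℂ)
    {V : PowerSeries ℂ} (hV : PowerSeries.constantCoeff V = 1) (n i j : ℕ) :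
    PowerSeries.coeff (n + 1) (pairing D U V (PowerSeries.X ^ (i + 1)) (PowerSeries.X ^ j)) =
      ∑ m ∈ Finset.range (n + 1), PowerSeries.coeff m (scaledLogDeriv D V) *
        PowerSeries.coeff n (pairing D U V (PowerSeries.X ^ i) (PowerSeries.X ^ (j + m))) +
      D⁻¹ * (j * PowerSeries.coeff n
        (pairing D U V (PowerSeries.X ^ i) (PowerSeries.X ^ (j - 1)))) := by
  simp only [pairing_comm D U V]
  exact coeff_pairing_X_pow_succ_right hD U hV n j i

/-- The Euler operator z d/dz is diagonal on monomials, so it can be moved from the Hadamard product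
onto the factor `U`, where zU' = D z f U with f the scaled logarithmic derivative. -/
theorem coeff_scaledLogDeriv_hadamard {D : ℂ} (hD : D ≠ 0) {U V : PowerSeries ℂ}
    (hU : PowerSeries.constantCoeff U = 1) (n : ℕ) :
    PowerSeries.coeff n (scaledLogDeriv D (hadamard D U V)) =
      ∑ m ∈ Finset.range (n + 1), PowerSeries.coeff m (scaledLogDeriv D U) *
        PowerSeries.coeff (n + 1) (pairing D U V (PowerSeries.X ^ (m + 1)) 1) := by
  have h2 : PowerSeries.C D⁻¹ * PowerSeries.C D = (1 : PowerSeries ℂ) := by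
    rw [← map_mul, inv_mul_cancel₀ hD, map_one]
  have h1 : PowerSeries.X * PowerSeries.derivative ℂ (hadamard D U V) =
      hadamard D (PowerSeries.X * PowerSeries.derivative ℂ U) V := by
    ext k
    cases k with
    | zero => simp [coeff_hadamard]
    | succ k =>
      rw [PowerSeries.coeff_succ_X_mul, PowerSeries.coeff_derivative, coeff_hadamard,
        coeff_hadamard, PowerSeries.coeff_succ_X_mul, PowerSeries.coeff_derivative]
      ring
  have h3 : PowerSeries.X * scaledLogDeriv D (hadamard D U V) =
      pairing D U V (PowerSeries.X * scaledLogDeriv D U) 1 := by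
    calc PowerSeries.X * scaledLogDeriv D (hadamard D U V)
        = PowerSeries.C D⁻¹ * (PowerSeries.X * PowerSeries.derivative ℂ (hadamard D U V)) *
          (hadamard D U V)⁻¹ := by rw [scaledLogDeriv]; ring
      _ = PowerSeries.C D⁻¹ * hadamard D (PowerSeries.C D *
            (PowerSeries.X * scaledLogDeriv D U * U)) V * (hadamard D U V)⁻¹ := by
          rw [h1, derivative_eq_scaledLogDeriv hD hU]
          rw [← mul_assoc PowerSeries.X, mul_left_comm PowerSeries.X, mul_assoc (PowerSeries.C D)]
      _ = _ := by
          rw [hadamard_C_mul_left, ← mul_assoc, h2, one_mul, pairing, one_mul]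
  -- The expansion runs up to m = n + 1, but its last term pairs z^(n+2) and has no coefficient of
  -- order n + 1.
  rw [← PowerSeries.coeff_succ_X_mul, h3, coeff_pairing_mul_left, Finset.sum_range_succ,
    ← pow_succ', ← mul_one (PowerSeries.X ^ (n + 1 + 1)),
    coeff_pairing_X_pow_mul_left D U V 1 1 (Nat.lt_succ_self (n + 1)), mul_zero, add_zero]
  simp only [pow_succ']

/-! ### Composition of power series and the limit of the pairing -/

/-- The composition `∑ m, f m xᵐ`, for a power series `x` without constant term. -/
noncomputable def compose (f : ℕ → ℂ) (x : PowerSeries ℂ) : PowerSeries ℂ :=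
  PowerSeries.mk fun n => ∑ m ∈ Finset.range (n + 1), f m * PowerSeries.coeff n (x ^ m)

theorem coeff_mul_pow_of_lt {x : PowerSeries ℂ} (hx : PowerSeries.constantCoeff x = 0)
    (A : PowerSeries ℂ) {n m : ℕ} (h : n < m) : PowerSeries.coeff n (A * x ^ m) = 0 := by
  obtain ⟨y, rfl⟩ := PowerSeries.X_dvd_iff.mpr hx
  rw [mul_pow, mul_left_comm, PowerSeries.coeff_X_pow_mul', if_neg (not_le.mpr h)]

theorem coeff_mul_compose {x : PowerSeries ℂ} (hx : PowerSeries.constantCoeff x = 0)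
    (f : ℕ → ℂ) (A : PowerSeries ℂ) (n : ℕ) :
    PowerSeries.coeff n (A * compose f x) =
      ∑ m ∈ Finset.range (n + 1), f m * PowerSeries.coeff n (A * x ^ m) := by
  have h : ∀ k ≤ n, PowerSeries.coeff k (compose f x) =
      ∑ m ∈ Finset.range (n + 1), f m * PowerSeries.coeff k (x ^ m) := by
    intro k hk
    rw [compose, PowerSeries.coeff_mk]
    refine Finset.sum_subset (Finset.range_mono (by omega)) fun m _ hm => ?_
    have hkm : k < m := by simpa [Nat.lt_succ_iff] using hm
    rw [← one_mul (x ^ m), coeff_mul_pow_of_lt hx 1 hkm, mul_zero]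
  simp only [PowerSeries.coeff_mul, Finset.mul_sum]
  rw [Finset.sum_comm]
  refine Finset.sum_congr rfl fun a ha => ?_
  have := Finset.HasAntidiagonal.mem_antidiagonal.mp ha
  rw [h a.2 (by omega), Finset.mul_sum]
  exact Finset.sum_congr rfl fun m _ => by ring

/-- Unrolling the recursion N times leaves the remainder `φ N * x ^ N`, whose order is at least N
because `x` has no constant term. -/
theorem eq_mul_compose_of_rec {x : PowerSeries ℂ} (hx : PowerSeries.constantCoeff x = 0)
    {f : ℕ → ℂ} {B : PowerSeries ℂ} {φ : ℕ → PowerSeries ℂ}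
    (h : ∀ i, φ i = PowerSeries.C (f i) * B + x * φ (i + 1)) : φ 0 = B * compose f x := by
  have key : ∀ N : ℕ,
      φ 0 = ∑ m ∈ Finset.range N, PowerSeries.C (f m) * (B * x ^ m) + φ N * x ^ N := by
    intro N
    induction N with
    | zero => simp
    | succ N ih =>
      rw [ih, Finset.sum_range_succ, h N]
      ring
  ext n
  rw [key (n + 1), map_add, coeff_mul_pow_of_lt hx _ (Nat.lt_succ_self n), add_zero, map_sum,
    coeff_mul_compose hx]
  simp only [PowerSeries.coeff_C_mul]

/-- The power series `x` and `y` solve `x = z g(y)` and `y = z f(x)`. -/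
structure IsTreeSystem (f g : ℕ → ℂ) (x y : PowerSeries ℂ) : Prop where
  left_eq : x = PowerSeries.X * compose g y
  right_eq : y = PowerSeries.X * compose f x

namespace IsTreeSystem

variable {f g : ℕ → ℂ} {x y : PowerSeries ℂ}

theorem symm (h : IsTreeSystem f g x y) : IsTreeSystem g f y x := ⟨h.right_eq, h.left_eq⟩

theorem constantCoeff_left (h : IsTreeSystem f g x y) : PowerSeries.constantCoeff x = 0 := by
  rw [h.left_eq]
  simp

/-- The recursion of `coeff_pairing_X_pow_succ_right` with the D⁻¹ term removed; the limit argument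
compares the two. -/
theorem coeff_pow_succ_right (h : IsTreeSystem f g x y) (n i j : ℕ) :
    PowerSeries.coeff (n + 1) (x ^ i * y ^ (j + 1)) =
      ∑ m ∈ Finset.range (n + 1), f m * PowerSeries.coeff n (x ^ (i + m) * y ^ j) := by
  have h1 : x ^ i * y ^ (j + 1) = PowerSeries.X * (x ^ i * y ^ j * compose f x) := by
    rw [pow_succ]
    nth_rewrite 2 [h.right_eq]
    ring
  rw [h1, PowerSeries.coeff_succ_X_mul, coeff_mul_compose h.constantCoeff_left]
  refine Finset.sum_congr rfl fun m _ => ?_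
  rw [pow_add, mul_right_comm]

theorem coeff_pow_succ_left (h : IsTreeSystem f g x y) (n i j : ℕ) :
    PowerSeries.coeff (n + 1) (x ^ (i + 1) * y ^ j) =
      ∑ m ∈ Finset.range (n + 1), g m * PowerSeries.coeff n (x ^ i * y ^ (j + m)) := by
  rw [mul_comm, h.symm.coeff_pow_succ_right]
  simp only [mul_comm]

end IsTreeSystem

/-! ### Factorisation of the pairing as D⁻¹ tends to zero -/

section Limit

variable {D : ℕ → ℂ} {U V : ℕ → PowerSeries ℂ} {f g : ℕ → ℂ} {x y : PowerSeries ℂ}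

/-- Induction on the order n: the recursions for the pairing and for x^i y^j differ only by a term
with the factor D⁻¹, which vanishes in the limit. Only the indices below n of `f` and `g` enter,
which matters for the inversion below. -/
theorem tendsto_coeff_pairing (hxy : IsTreeSystem f g x y)
    (hD : ∀ᶠ d in atTop, D d ≠ 0) (hD' : Tendsto (fun d => (D d)⁻¹) atTop (𝓝 0))
    (hU : ∀ᶠ d in atTop, PowerSeries.constantCoeff (U d) = 1)
    (hV : ∀ᶠ d in atTop, PowerSeries.constantCoeff (V d) = 1) (n : ℕ)
    (hf : ∀ m < n, Tendsto (fun d => PowerSeries.coeff m (scaledLogDeriv (D d) (U d))) atTop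
      (𝓝 (f m)))
    (hg : ∀ m < n, Tendsto (fun d => PowerSeries.coeff m (scaledLogDeriv (D d) (V d))) atTop
      (𝓝 (g m))) (i j : ℕ) :
    Tendsto (fun d => PowerSeries.coeff n
      (pairing (D d) (U d) (V d) (PowerSeries.X ^ i) (PowerSeries.X ^ j))) atTop
      (𝓝 (PowerSeries.coeff n (x ^ i * y ^ j))) := by
  -- The case i = j = 0 is reached by neither recursion; there the normalisation makes the pairing
  -- exactly 1.
  have hz : ∀ n, Tendsto (fun d => PowerSeries.coeff n
      (pairing (D d) (U d) (V d) (PowerSeries.X ^ 0) (PowerSeries.X ^ 0))) atTop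
      (𝓝 (PowerSeries.coeff n (x ^ 0 * y ^ 0))) := by
    intro n
    refine tendsto_const_nhds.congr' ?_
    filter_upwards [hU, hV] with d h1 h2
    simp only [pow_zero]
    rw [pairing_one_one h1 h2, mul_one]
  induction n generalizing i j with
  | zero =>
    rcases i with - | i
    · rcases j with - | j
      · exact hz 0
      · rw [coeff_mul_pow_of_lt hxy.symm.constantCoeff_left _ (Nat.succ_pos j)]
        refine tendsto_const_nhds.congr fun d => ?_
        rw [pairing_comm, ← mul_one (PowerSeries.X ^ (j + 1)),
          coeff_pairing_X_pow_mul_left _ _ _ _ _ (Nat.succ_pos j)]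
    · rw [mul_comm, coeff_mul_pow_of_lt hxy.constantCoeff_left _ (Nat.succ_pos i)]
      refine tendsto_const_nhds.congr fun d => ?_
      rw [← mul_one (PowerSeries.X ^ (i + 1)),
        coeff_pairing_X_pow_mul_left _ _ _ _ _ (Nat.succ_pos i)]
  | succ n ih =>
    have ih' := ih (fun m hm => hf m (by omega)) (fun m hm => hg m (by omega))
    -- For j = 0 no factor can be removed on the right, so one is removed on the left; the D⁻¹ term
    -- then carries the factor j = 0 and is absent.
    rcases j with - | j
    · rcases i with - | i
      · exact hz _
      · rw [hxy.coeff_pow_succ_left]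
        have : Tendsto (fun d => ∑ m ∈ Finset.range (n + 1),
            PowerSeries.coeff m (scaledLogDeriv (D d) (V d)) *
              PowerSeries.coeff n (pairing (D d) (U d) (V d)
                (PowerSeries.X ^ i) (PowerSeries.X ^ (0 + m)))) atTop
            (𝓝 (∑ m ∈ Finset.range (n + 1), g m * PowerSeries.coeff n (x ^ i * y ^ (0 + m)))) :=
          tendsto_finsetSum _ fun m hm => (hg m (Finset.mem_range.mp hm)).mul (ih' _ _)
        refine this.congr' ?_
        filter_upwards [hD, hV] with d h1 h2
        rw [coeff_pairing_X_pow_succ_left h1 _ h2]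
        simp
    · rw [hxy.coeff_pow_succ_right]
      have : Tendsto (fun d => ∑ m ∈ Finset.range (n + 1),
          PowerSeries.coeff m (scaledLogDeriv (D d) (U d)) *
            PowerSeries.coeff n (pairing (D d) (U d) (V d)
              (PowerSeries.X ^ (i + m)) (PowerSeries.X ^ j)) +
          (D d)⁻¹ * (i * PowerSeries.coeff n
            (pairing (D d) (U d) (V d) (PowerSeries.X ^ (i - 1)) (PowerSeries.X ^ j)))) atTop
          (𝓝 (∑ m ∈ Finset.range (n + 1), f m * PowerSeries.coeff n (x ^ (i + m) * y ^ j) +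
            0 * (i * PowerSeries.coeff n (x ^ (i - 1) * y ^ j)))) :=
        (tendsto_finsetSum _ fun m hm => (hf m (Finset.mem_range.mp hm)).mul (ih' _ _)).add
          (hD'.mul (tendsto_const_nhds.mul (ih' _ _)))
      rw [zero_mul, add_zero] at this
      refine this.congr' ?_
      filter_upwards [hD, hU] with d h1 h2
      rw [coeff_pairing_X_pow_succ_right h1 _ h2]

/-- Removing the first factor z on the left brings in `g` instead of `f`. Order n + 1 is thus
reached with `f` known only below n, which is the gain that makes the inversion triangular. -/
theorem tendsto_coeff_succ_pairing_X_pow_left (hxy : IsTreeSystem f g x y)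
    (hD : ∀ᶠ d in atTop, D d ≠ 0) (hD' : Tendsto (fun d => (D d)⁻¹) atTop (𝓝 0))
    (hU : ∀ᶠ d in atTop, PowerSeries.constantCoeff (U d) = 1)
    (hV : ∀ᶠ d in atTop, PowerSeries.constantCoeff (V d) = 1) (n : ℕ)
    (hf : ∀ m < n, Tendsto (fun d => PowerSeries.coeff m (scaledLogDeriv (D d) (U d))) atTop
      (𝓝 (f m)))
    (hg : ∀ m, Tendsto (fun d => PowerSeries.coeff m (scaledLogDeriv (D d) (V d))) atTop
      (𝓝 (g m))) (i : ℕ) :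
    Tendsto (fun d => PowerSeries.coeff (n + 1)
      (pairing (D d) (U d) (V d) (PowerSeries.X ^ (i + 1)) 1)) atTop
      (𝓝 (PowerSeries.coeff (n + 1) (x ^ (i + 1)))) := by
  have hz : x ^ (i + 1) = x ^ (i + 1) * y ^ 0 := by rw [pow_zero, mul_one]
  rw [hz, hxy.coeff_pow_succ_left]
  have : Tendsto (fun d => ∑ m ∈ Finset.range (n + 1),
      PowerSeries.coeff m (scaledLogDeriv (D d) (V d)) *
        PowerSeries.coeff n (pairing (D d) (U d) (V d)
          (PowerSeries.X ^ i) (PowerSeries.X ^ (0 + m)))) atTop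
      (𝓝 (∑ m ∈ Finset.range (n + 1), g m * PowerSeries.coeff n (x ^ i * y ^ (0 + m)))) :=
    tendsto_finsetSum _ fun m _ => (hg m).mul
      (tendsto_coeff_pairing hxy hD hD' hU hV n hf (fun m _ => hg m) _ _)
  refine this.congr' ?_
  filter_upwards [hD, hV] with d h1 h2
  rw [← pow_zero (PowerSeries.X : PowerSeries ℂ), coeff_pairing_X_pow_succ_left h1 _ h2]
  simp

/-- The coefficients of `D⁻¹ log` of a Hadamard product converge to the tree series. -/
theorem tendsto_coeff_scaledLogDeriv_hadamard (hxy : IsTreeSystem f g x y)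
    (hD : ∀ᶠ d in atTop, D d ≠ 0) (hD' : Tendsto (fun d => (D d)⁻¹) atTop (𝓝 0))
    (hU : ∀ᶠ d in atTop, PowerSeries.constantCoeff (U d) = 1)
    (hV : ∀ᶠ d in atTop, PowerSeries.constantCoeff (V d) = 1)
    (hf : ∀ m, Tendsto (fun d => PowerSeries.coeff m (scaledLogDeriv (D d) (U d))) atTop
      (𝓝 (f m)))
    (hg : ∀ m, Tendsto (fun d => PowerSeries.coeff m (scaledLogDeriv (D d) (V d))) atTop
      (𝓝 (g m))) (n : ℕ) :
    Tendsto (fun d => PowerSeries.coeff n (scaledLogDeriv (D d) (hadamard (D d) (U d) (V d))))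
      atTop (𝓝 (∑ m ∈ Finset.range (n + 1), f m * PowerSeries.coeff (n + 1) (x ^ (m + 1)))) := by
  refine (tendsto_finsetSum _ fun m _ => (hf m).mul (tendsto_coeff_succ_pairing_X_pow_left hxy
    hD hD' hU hV n (fun m _ => hf m) hg m)).congr' ?_
  filter_upwards [hD, hU] with d h1 h2
  rw [coeff_scaledLogDeriv_hadamard h1 h2]

/-- If the second factor and the Hadamard product have the expected limits, then so does the
first factor, provided that the second one is nondegenerate. -/
theorem tendsto_coeff_scaledLogDeriv_of_hadamard (hxy : IsTreeSystem f g x y)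
    (hD : ∀ᶠ d in atTop, D d ≠ 0) (hD' : Tendsto (fun d => (D d)⁻¹) atTop (𝓝 0))
    (hU : ∀ᶠ d in atTop, PowerSeries.constantCoeff (U d) = 1)
    (hV : ∀ᶠ d in atTop, PowerSeries.constantCoeff (V d) = 1)
    (hg : ∀ m, Tendsto (fun d => PowerSeries.coeff m (scaledLogDeriv (D d) (V d))) atTop
      (𝓝 (g m)))
    (hx : PowerSeries.coeff 1 x ≠ 0)
    (hh : ∀ n, Tendsto (fun d =>
      PowerSeries.coeff n (scaledLogDeriv (D d) (hadamard (D d) (U d) (V d)))) atTop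
      (𝓝 (∑ m ∈ Finset.range (n + 1), f m * PowerSeries.coeff (n + 1) (x ^ (m + 1))))) (n : ℕ) :
    Tendsto (fun d => PowerSeries.coeff n (scaledLogDeriv (D d) (U d))) atTop (𝓝 (f n)) := by
  induction n using Nat.strong_induction_on with
  | _ n ih =>
    have ht := tendsto_coeff_succ_pairing_X_pow_left hxy hD hD' hU hV n ih hg
    -- Writing x = z·z₁, this leading coefficient is the (n + 1)-st power of the linear coefficient
    -- of x.
    have hne : PowerSeries.coeff (n + 1) (x ^ (n + 1)) ≠ 0 := by
      obtain ⟨z, rfl⟩ := PowerSeries.X_dvd_iff.mpr hxy.constantCoeff_left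
      rw [mul_pow, PowerSeries.coeff_X_pow_mul', if_pos le_rfl, Nat.sub_self]
      rw [← zero_add 1, PowerSeries.coeff_succ_X_mul] at hx
      simpa using hx
    -- In the formula for the Hadamard product the index n occurs only in the last summand; subtract
    -- the earlier ones and divide by the nonzero leading coefficient.
    have h1 := ((hh n).sub (tendsto_finsetSum (Finset.range n) fun m hm =>
      (ih m (Finset.mem_range.mp hm)).mul (ht m))).div (ht n) hne
    rw [Finset.sum_range_succ, add_sub_cancel_left, mul_div_cancel_right₀ _ hne] at h1
    refine h1.congr' ?_
    filter_upwards [hD, hU, (ht n).eventually_ne hne] with d h2 h3 h4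
    rw [Pi.div_apply, coeff_scaledLogDeriv_hadamard h2 h3, Finset.sum_range_succ, add_sub_cancel_left,
      mul_div_cancel_right₀ _ h4]

end Limit

/-! ### Partitions as equivalence relations, and the Kreweras complement -/

/-- The equivalence relation whose classes are the blocks of a partition. -/
def relOf {n : ℕ} (π : SetPartition n) : Setoid (Fin n) := Setoid.ker π.part

theorem relOf_iff {n : ℕ} {π : SetPartition n} {x y : Fin n} :
    relOf π x y ↔ π.part x = π.part y := Iff.rfl

theorem mem_part_iff_relOf {n : ℕ} {π : SetPartition n} {x y : Fin n} :
    y ∈ π.part x ↔ relOf π x y := by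
  rw [relOf_iff, π.mem_part_iff_part_eq_part (Finset.mem_univ y) (Finset.mem_univ x), eq_comm]

theorem relOf_of_mem_parts {n : ℕ} {π : SetPartition n} {V : Finset (Fin n)} (hV : V ∈ π.parts)
    {x y : Fin n} (hx : x ∈ V) : relOf π x y ↔ y ∈ V := by
  rw [← mem_part_iff_relOf, π.part_eq_of_mem hV hx]

open Classical in
theorem relOf_ofSetoid {n : ℕ} (s : Setoid (Fin n)) : relOf (Finpartition.ofSetoid s) = s := by
  ext x y
  rw [← mem_part_iff_relOf, Finpartition.mem_part_ofSetoid_iff_rel]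

theorem relOf_injective {n : ℕ} : Function.Injective (relOf (n := n)) := by
  have h : ∀ π ρ : SetPartition n, relOf π = relOf ρ → π.parts ⊆ ρ.parts := by
    intro π ρ h V hV
    obtain ⟨x, hx⟩ := π.nonempty_of_mem_parts hV
    have : V = ρ.part x := by
      ext y
      rw [← relOf_of_mem_parts hV hx, h, mem_part_iff_relOf]
    rw [this]
    exact ρ.part_mem.mpr (Finset.mem_univ x)
  intro π ρ hπρ
  exact Finpartition.ext (Finset.Subset.antisymm (h π ρ hπρ) (h ρ π hπρ.symm))

/-- The relation `r` has no crossing. -/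
def NonCrossingRel {n : ℕ} (r : Setoid (Fin n)) : Prop :=
  ∀ i j k l : Fin n, i < j → j < k → k < l → r i k → r j l → r i j

theorem isNonCrossing_iff {n : ℕ} {π : SetPartition n} :
    IsNonCrossing π ↔ NonCrossingRel (relOf π) := by
  constructor
  · intro h i j k l hij hjk hkl hik hjl
    exact h i j k l hij hjk hkl _ (π.part_mem.mpr (Finset.mem_univ i)) _
      (π.part_mem.mpr (Finset.mem_univ j)) (π.mem_part_self.mpr (Finset.mem_univ i))
      (mem_part_iff_relOf.mpr hik) (π.mem_part_self.mpr (Finset.mem_univ j))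
      (mem_part_iff_relOf.mpr hjl)
  · intro h i j k l hij hjk hkl V hV W hW hiV hkV hjW hlW
    have := h i j k l hij hjk hkl ((relOf_of_mem_parts hV hiV).mpr hkV)
      ((relOf_of_mem_parts hW hjW).mpr hlW)
    exact π.eq_of_mem_parts hV hW ((relOf_of_mem_parts hV hiV).mp this) hjW

theorem mem_NC_iff {n : ℕ} {π : SetPartition n} : π ∈ NC n ↔ NonCrossingRel (relOf π) := by
  classical
  rw [NC, Finset.mem_filter, isNonCrossing_iff]
  simp

/-- `x` and `y` are related if the interval between `x` (excluded) and `y` (included), or between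
`y` and `x`, is a union of classes of `r`. -/
def intervalRel {n : ℕ} (r : Setoid (Fin n)) : Setoid (Fin n) where
  r x y := ∀ u v, r u v → ((x < u ↔ y < u) ↔ (x < v ↔ y < v))
  iseqv :=
    { refl := fun x u v _ => by simp
      symm := fun h u v huv => by have := h u v huv; tauto
      trans := fun h h' u v huv => by have := h u v huv; have := h' u v huv; tauto }

theorem intervalRel_iff {n : ℕ} {r : Setoid (Fin n)} {x y : Fin n} :
    intervalRel r x y ↔ ∀ u v, r u v → ((x < u ↔ y < u) ↔ (x < v ↔ y < v)) := Iff.rfl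

theorem finRotate_val {n : ℕ} (x : Fin n) :
    (finRotate n x : ℕ) = x + 1 ∨ (finRotate n x : ℕ) = 0 ∧ (x : ℕ) + 1 = n := by
  cases n with
  | zero => exact x.elim0
  | succ c =>
    by_cases h : x = Fin.last c
    · right
      rw [h, finRotate_last]
      simp
    · exact Or.inl (coe_finRotate_of_ne_last h)

/-- An order-theoretic form of the cycle: either the image is the next element of the class, or the
point is the maximum of its class and the image is the minimum. The Kreweras argument uses
`blockPerm` only through this. -/
theorem blockPerm_spec {n : ℕ} (π : SetPartition n) (w : Fin n) :
    relOf π w (blockPerm π w) ∧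
      ((w < blockPerm π w ∧ ∀ y, relOf π w y → ¬ (w < y ∧ y < blockPerm π w)) ∨
        ∀ y, relOf π w y → blockPerm π w ≤ y ∧ y ≤ w) := by
  set V := π.part w with hVdef
  have hV : V ∈ π.parts := π.part_mem.mpr (Finset.mem_univ w)
  have hwV : w ∈ V := π.mem_part_self.mpr (Finset.mem_univ w)
  have hsurj : ∀ y ∈ V, ∃ k, V.orderEmbOfFin rfl k = y := by
    intro y hy
    have : y ∈ Set.range (V.orderEmbOfFin rfl) := by
      rw [Finset.range_orderEmbOfFin]; exact hy
    exact this
  obtain ⟨k, hk⟩ := hsurj w hwV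
  have hα : blockPerm π w = V.orderEmbOfFin rfl (finRotate V.card k) := by
    rw [← hk, blockPerm_apply π hV]
  have hrel : ∀ y, relOf π w y ↔ y ∈ V := fun y => relOf_of_mem_parts hV hwV
  rw [hα]
  simp only [hrel]
  refine ⟨Finset.orderEmbOfFin_mem _ _ _, ?_⟩
  have hrot := finRotate_val k
  rcases hrot with h1 | ⟨h1, h2⟩
  · left
    constructor
    · conv_lhs => rw [← hk]
      exact (V.orderEmbOfFin rfl).lt_iff_lt.mpr (by rw [Fin.lt_def]; omega)
    · intro y hy
      obtain ⟨l, rfl⟩ := hsurj y hy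
      conv in w < _ => rw [← hk]
      rw [OrderEmbedding.lt_iff_lt, OrderEmbedding.lt_iff_lt, Fin.lt_def, Fin.lt_def]
      omega
  · right
    intro y hy
    obtain ⟨l, rfl⟩ := hsurj y hy
    conv in _ ≤ w => rw [← hk]
    rw [OrderEmbedding.le_iff_le, OrderEmbedding.le_iff_le, Fin.le_def, Fin.le_def]
    omega

/-- With w = α⁻¹(x + 1), cyclically, the pair w, x + 1 is consecutive in a class. A class lying
partly inside and partly outside the stretch cut off by this pair would cross it. -/
theorem intervalRel_step {n : ℕ} {π : SetPartition n} (hπ : NonCrossingRel (relOf π))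
    (x : Fin n) : intervalRel (relOf π) x (((blockPerm π)⁻¹ * finRotate n) x) := by
  set w := ((blockPerm π)⁻¹ * finRotate n) x with hw
  have hz : blockPerm π w = finRotate n x := by simp [hw]
  obtain ⟨hwz, hcase⟩ := blockPerm_spec π w
  rw [hz] at hwz hcase
  set z := finRotate n x with hzdef
  set r := relOf π
  have hx : (z : ℕ) = x + 1 ∨ (z : ℕ) = 0 ∧ (x : ℕ) + 1 = n := finRotate_val x
  -- The points on which `x < u` and `w < u` disagree form the interval between x and w; it has to
  -- be a union of classes.
  have hclosed : ∀ u v, r u v → ¬(x < u ↔ w < u) → ¬(x < v ↔ w < v) := by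
    intro u v huv hu
    have hwu : r w u → r w v := fun h => r.trans' h huv
    have hwv : r w v → r w u := fun h => r.trans' h (r.symm' huv)
    simp only [Fin.lt_def, Fin.le_def] at hcase hu ⊢
    intro hv
    -- If z follows w, the interval consists of the points strictly between w and z. If w is the
    -- maximum and z the minimum of the class, it is [z, w], or the complement of [0, w] when z = 0.
    rcases hcase with ⟨hlt, hgap⟩ | hall
    · have hnu : ¬ r w u := fun h => hgap u h (by omega)
      have hnv : ¬ r w v := fun h => hnu (hwv h)
      have h1 : v ≠ w := fun h => hnv (h ▸ r.refl' w)
      have h2 : v ≠ z := fun h => hnv (h ▸ hwz)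
      rw [Ne, Fin.ext_iff] at h1 h2
      by_cases h3 : (v : ℕ) < w
      · exact hnv (r.symm' (hπ v w u z (by rw [Fin.lt_def]; omega) (by rw [Fin.lt_def]; omega)
          (by rw [Fin.lt_def]; omega) (r.symm' huv) hwz))
      · exact hnu (hπ w u z v (by rw [Fin.lt_def]; omega) (by rw [Fin.lt_def]; omega)
          (by rw [Fin.lt_def]; omega) hwz huv)
    · have hzw := hall z hwz
      have hnu : ¬ r w u := fun h => by
        have := hall u h
        have := hall v (hwu h)
        omega
      have hnv : ¬ r w v := fun h => hnu (hwv h)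
      have h1 : v ≠ w := fun h => hnv (h ▸ r.refl' w)
      have h2 : v ≠ z := fun h => hnv (h ▸ hwz)
      have h3 : u ≠ w := fun h => hnu (h ▸ r.refl' w)
      have h4 : u ≠ z := fun h => hnu (h ▸ hwz)
      rw [Ne, Fin.ext_iff] at h1 h2 h3 h4
      by_cases h5 : (u : ℕ) < w
      · by_cases h6 : (v : ℕ) < z
        · exact hnv (r.trans' hwz (r.symm' (hπ v z u w (by rw [Fin.lt_def]; omega)
            (by rw [Fin.lt_def]; omega) (by rw [Fin.lt_def]; omega) (r.symm' huv)
            (r.symm' hwz))))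
        · exact hnu (r.trans' hwz (hπ z u w v (by rw [Fin.lt_def]; omega)
            (by rw [Fin.lt_def]; omega) (by rw [Fin.lt_def]; omega) (r.symm' hwz) huv))
      · exact hnv (r.trans' hwz (hπ z v w u (by rw [Fin.lt_def]; omega)
          (by rw [Fin.lt_def]; omega) (by rw [Fin.lt_def]; omega) (r.symm' hwz) (r.symm' huv)))
  rw [intervalRel_iff]
  intro u v huv
  have h1 := hclosed u v huv
  have h2 := hclosed v u (r.symm' huv)
  tauto

/-- One direction iterates the single step. For the other, let x < y: the interval (x, y] contains x
+ 1, hence also β(x), which is in the same class as x + 1. So β(x) is closer to y, and induction on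
the distance applies. -/
theorem sameCycle_iff_intervalRel {n : ℕ} {π : SetPartition n}
    (hπ : NonCrossingRel (relOf π)) (x y : Fin n) :
    ((blockPerm π)⁻¹ * finRotate n).SameCycle x y ↔ intervalRel (relOf π) x y := by
  set β := (blockPerm π)⁻¹ * finRotate n with hβ
  constructor
  · intro h
    obtain ⟨k, rfl⟩ := h.exists_nat_pow_eq
    clear h
    induction k with
    | zero => exact Setoid.refl' _ _
    | succ k ih =>
      rw [pow_succ', Equiv.Perm.mul_apply]
      exact Setoid.trans' _ ih (intervalRel_step hπ _)
  · have key : ∀ m : ℕ, ∀ x y : Fin n, (y : ℕ) = x + m → intervalRel (relOf π) x y →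
        β.SameCycle x y := by
      intro m
      induction m using Nat.strong_induction_on with
      | _ m ih =>
        intro x y hxy h
        rcases Nat.eq_zero_or_pos m with rfl | hm
        · rw [show y = x from Fin.ext hxy]
        · have hstep := intervalRel_step hπ x
          have hz : blockPerm π (β x) = finRotate n x := by simp [hβ]
          have hrel := (blockPerm_spec π (β x)).1
          rw [hz] at hrel
          have hx : (finRotate n x : ℕ) = x + 1 := by
            have := finRotate_val x
            have := y.isLt
            omega
          have h1 := h _ _ hrel
          simp only [Fin.lt_def, hx] at h1
          have h2 := ih (y - β x) (by omega) (β x) y (by omega)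
            (Setoid.trans' _ (Setoid.symm' _ hstep) h)
          exact (Equiv.Perm.sameCycle_apply_right.mpr (Equiv.Perm.SameCycle.refl β x)).trans h2
    intro h
    rcases le_total x y with hxy | hxy
    · exact key (y - x) x y (by have := Fin.le_def.mp hxy; omega) h
    · exact (key (x - y) y x (by have := Fin.le_def.mp hxy; omega) (Setoid.symm' _ h)).symm

theorem relOf_kreweras {n : ℕ} {π : SetPartition n} (hπ : π ∈ NC n) :
    relOf (kreweras π) = intervalRel (relOf π) := by
  rw [kreweras, cyclePartition, relOf_ofSetoid]
  ext x y
  exact sameCycle_iff_intervalRel (mem_NC_iff.mp hπ) x y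

/-! ### Weights of partitions -/

open Classical in
/-- The size of the class of `x`. -/
noncomputable def classCard {n : ℕ} (r : Setoid (Fin n)) (x : Fin n) : ℕ :=
  (Finset.univ.filter fun y => r x y).card

theorem classCard_relOf {n : ℕ} (π : SetPartition n) {V : Finset (Fin n)} (hV : V ∈ π.parts)
    {x : Fin n} (hx : x ∈ V) : classCard (relOf π) x = V.card := by
  classical
  rw [classCard]
  congr 1
  ext y
  rw [Finset.mem_filter, relOf_of_mem_parts hV hx]
  simp

open Classical in
/-- The product over the classes of `r` of `u` at their size, where the class of `0` counts for
`i` more elements. Each class is represented by its least element. -/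
noncomputable def minWeight (u : ℕ → ℂ) (i : ℕ) {n : ℕ} (r : Setoid (Fin n)) : ℂ :=
  ∏ x, if ∀ y, r x y → x ≤ y then u (classCard r x + if (x : ℕ) = 0 then i else 0) else 1

open Classical in
/-- The product over the classes of `r` of `u` at their size, where the class of the last element
counts for `j` more elements. Each class is represented by its greatest element. -/
noncomputable def maxWeight (u : ℕ → ℂ) (j : ℕ) {n : ℕ} (r : Setoid (Fin n)) : ℂ :=
  ∏ x, if ∀ y, r x y → y ≤ x then u (classCard r x + if (x : ℕ) + 1 = n then j else 0) else 1

open Classical in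
/-- The product over the classes of `r` that have their least element different from `0`. -/
noncomputable def tailWeight (u : ℕ → ℂ) {n : ℕ} (r : Setoid (Fin (n + 1))) : ℂ :=
  ∏ x : Fin n, if ∀ y, r x.succ y → x.succ ≤ y then u (classCard r x.succ) else 1

theorem blockProd_eq_minWeight (u : ℕ → ℂ) {n : ℕ} (π : SetPartition n) :
    blockProd u π = minWeight u 0 (relOf π) := by
  classical
  rw [minWeight, ← Finset.prod_filter, blockProd]
  refine Finset.prod_bij (fun V hV => V.min' (π.nonempty_of_mem_parts hV)) ?_ ?_ ?_ ?_
  · intro V hV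
    rw [Finset.mem_filter]
    refine ⟨Finset.mem_univ _, fun y hy => ?_⟩
    exact Finset.min'_le V y ((relOf_of_mem_parts hV (Finset.min'_mem V _)).mp hy)
  · intro V hV W hW h
    exact π.eq_of_mem_parts hV hW (Finset.min'_mem V (π.nonempty_of_mem_parts hV))
      (h ▸ Finset.min'_mem W (π.nonempty_of_mem_parts hW))
  · intro x hx
    refine ⟨π.part x, π.part_mem.mpr (Finset.mem_univ x), ?_⟩
    refine le_antisymm (Finset.min'_le _ _ (π.mem_part_self.mpr (Finset.mem_univ x))) ?_
    exact (Finset.mem_filter.mp hx).2 _ (mem_part_iff_relOf.mp (Finset.min'_mem _ _))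
  · intro V hV
    rw [classCard_relOf π hV (Finset.min'_mem V _)]
    simp

theorem blockProd_eq_maxWeight (u : ℕ → ℂ) {n : ℕ} (π : SetPartition n) :
    blockProd u π = maxWeight u 0 (relOf π) := by
  classical
  rw [maxWeight, ← Finset.prod_filter, blockProd]
  refine Finset.prod_bij (fun V hV => V.max' (π.nonempty_of_mem_parts hV)) ?_ ?_ ?_ ?_
  · intro V hV
    rw [Finset.mem_filter]
    refine ⟨Finset.mem_univ _, fun y hy => ?_⟩
    exact Finset.le_max' V y ((relOf_of_mem_parts hV (Finset.max'_mem V _)).mp hy)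
  · intro V hV W hW h
    exact π.eq_of_mem_parts hV hW (Finset.max'_mem V (π.nonempty_of_mem_parts hV))
      (h ▸ Finset.max'_mem W (π.nonempty_of_mem_parts hW))
  · intro x hx
    refine ⟨π.part x, π.part_mem.mpr (Finset.mem_univ x), ?_⟩
    refine le_antisymm ?_ (Finset.le_max' _ _ (π.mem_part_self.mpr (Finset.mem_univ x)))
    exact (Finset.mem_filter.mp hx).2 _ (mem_part_iff_relOf.mp (Finset.max'_mem _ _))
  · intro V hV
    rw [classCard_relOf π hV (Finset.max'_mem V _)]
    simp

/-! ### Adjoining a singleton -/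

/-- The class of `0` is a singleton. -/
def ZeroSingleton {n : ℕ} (r : Setoid (Fin (n + 1))) : Prop := ∀ y, r 0 y → y = 0

/-- Adjoin `0` as a singleton class. -/
def adjoinZero {n : ℕ} (t : Setoid (Fin n)) : Setoid (Fin (n + 1)) where
  r x y := (x = 0 ∧ y = 0) ∨ ∃ x' y', x = Fin.succ x' ∧ y = Fin.succ y' ∧ t x' y'
  iseqv :=
    { refl := fun x => by
        induction x using Fin.cases with
        | zero => exact Or.inl ⟨rfl, rfl⟩
        | succ x => exact Or.inr ⟨x, x, rfl, rfl, t.refl' x⟩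
      symm := by
        rintro x y (⟨rfl, rfl⟩ | ⟨x', y', rfl, rfl, h⟩)
        · exact Or.inl ⟨rfl, rfl⟩
        · exact Or.inr ⟨y', x', rfl, rfl, t.symm' h⟩
      trans := by
        rintro x y z (⟨rfl, rfl⟩ | ⟨x', y', rfl, rfl, h⟩) (⟨h1, rfl⟩ | ⟨y'', z', h1, rfl, h'⟩)
        · exact Or.inl ⟨rfl, rfl⟩
        · exact absurd h1.symm (Fin.succ_ne_zero _)
        · exact absurd h1 (Fin.succ_ne_zero _)
        · rw [Fin.succ_inj] at h1
          subst h1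
          exact Or.inr ⟨x', z', rfl, rfl, t.trans' h h'⟩ }

theorem adjoinZero_succ_succ {n : ℕ} {t : Setoid (Fin n)} {x y : Fin n} :
    adjoinZero t x.succ y.succ ↔ t x y := by
  change (_ ∨ _) ↔ _
  constructor
  · rintro (⟨h, _⟩ | ⟨x', y', h1, h2, h⟩)
    · exact absurd h (Fin.succ_ne_zero _)
    · rw [Fin.succ_inj] at h1 h2
      rwa [h1, h2]
  · exact fun h => Or.inr ⟨x, y, rfl, rfl, h⟩

theorem zeroSingleton_adjoinZero {n : ℕ} (t : Setoid (Fin n)) : ZeroSingleton (adjoinZero t) := by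
  rintro y (⟨_, h⟩ | ⟨x', y', h1, _, _⟩)
  · exact h
  · exact absurd h1.symm (Fin.succ_ne_zero _)

theorem comap_succ_adjoinZero {n : ℕ} (t : Setoid (Fin n)) :
    Setoid.comap Fin.succ (adjoinZero t) = t := by
  ext x y
  exact adjoinZero_succ_succ

theorem ZeroSingleton.eq_adjoinZero {n : ℕ} {r : Setoid (Fin (n + 1))} (hr : ZeroSingleton r) :
    adjoinZero (Setoid.comap Fin.succ r) = r := by
  have h0 : ∀ y : Fin n, ¬ r 0 y.succ := fun y hy => absurd (hr _ hy) (Fin.succ_ne_zero _)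
  have h1 : ∀ y : Fin n, ¬ adjoinZero (Setoid.comap Fin.succ r) 0 y.succ :=
    fun y hy => absurd (zeroSingleton_adjoinZero _ _ hy) (Fin.succ_ne_zero _)
  ext x y
  induction x using Fin.cases with
  | zero =>
    induction y using Fin.cases with
    | zero => exact ⟨fun _ => r.refl' 0, fun _ => Setoid.refl' _ 0⟩
    | succ y => exact ⟨fun h => absurd h (h1 y), fun h => absurd h (h0 y)⟩
  | succ x =>
    induction y using Fin.cases with
    | zero => exact ⟨fun h => absurd (Setoid.symm' _ h) (h1 x),
        fun h => absurd (r.symm' h) (h0 x)⟩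
    | succ y => exact adjoinZero_succ_succ

theorem ZeroSingleton.nonCrossingRel_iff {n : ℕ} {r : Setoid (Fin (n + 1))}
    (hr : ZeroSingleton r) :
    NonCrossingRel r ↔ NonCrossingRel (Setoid.comap Fin.succ r) := by
  constructor
  · intro h i j k l hij hjk hkl
    exact h i.succ j.succ k.succ l.succ (Fin.succ_lt_succ_iff.mpr hij)
      (Fin.succ_lt_succ_iff.mpr hjk) (Fin.succ_lt_succ_iff.mpr hkl)
  · intro h i j k l hij hjk hkl hik hjl
    have hj : j ≠ 0 := (Fin.pos_of_ne_zero (Fin.ne_zero_of_lt hij)).ne'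
    have hk : k ≠ 0 := Fin.ne_zero_of_lt hjk
    have hl : l ≠ 0 := Fin.ne_zero_of_lt hkl
    have hi : i ≠ 0 := by
      rintro rfl
      exact hk (hr k hik)
    obtain ⟨i, rfl⟩ := Fin.exists_succ_eq.mpr hi
    obtain ⟨j, rfl⟩ := Fin.exists_succ_eq.mpr hj
    obtain ⟨k, rfl⟩ := Fin.exists_succ_eq.mpr hk
    obtain ⟨l, rfl⟩ := Fin.exists_succ_eq.mpr hl
    rw [Fin.succ_lt_succ_iff] at hij hjk hkl
    exact h i j k l hij hjk hkl hik hjl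

open Classical in
theorem classCard_succ {n : ℕ} (r : Setoid (Fin (n + 1))) (x : Fin (n + 1)) :
    classCard r x = (if r x 0 then 1 else 0) +
      (Finset.univ.filter fun y : Fin n => r x y.succ).card := by
  rw [classCard, Finset.card_filter, Fin.sum_univ_succ, Finset.card_filter]

theorem ZeroSingleton.classCard_succ_eq {n : ℕ} {r : Setoid (Fin (n + 1))}
    (hr : ZeroSingleton r) (x : Fin n) :
    classCard r x.succ = classCard (Setoid.comap Fin.succ r) x := by
  classical
  have h : ¬ r x.succ 0 := fun h => Fin.succ_ne_zero x (hr _ (r.symm' h))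
  rw [classCard_succ, if_neg h, zero_add, classCard]
  rfl

theorem ZeroSingleton.classCard_zero {n : ℕ} {r : Setoid (Fin (n + 1))}
    (hr : ZeroSingleton r) : classCard r 0 = 1 := by
  classical
  rw [classCard, Finset.card_eq_one]
  refine ⟨0, ?_⟩
  ext y
  rw [Finset.mem_filter, Finset.mem_singleton]
  exact ⟨fun h => hr y h.2, fun h => ⟨Finset.mem_univ _, h ▸ r.refl' 0⟩⟩

theorem ZeroSingleton.minWeight_eq {n : ℕ} {r : Setoid (Fin (n + 1))}
    (hr : ZeroSingleton r) (u : ℕ → ℂ) (i : ℕ) :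
    minWeight u i r = u (1 + i) * tailWeight u r := by
  classical
  rw [minWeight, Fin.prod_univ_succ, if_pos fun y _ => Fin.zero_le y, hr.classCard_zero, tailWeight]
  simp

theorem ZeroSingleton.tailWeight_eq {n : ℕ} {r : Setoid (Fin (n + 1))}
    (hr : ZeroSingleton r) (u : ℕ → ℂ) :
    tailWeight u r = minWeight u 0 (Setoid.comap Fin.succ r) := by
  classical
  rw [minWeight, tailWeight]
  refine Finset.prod_congr rfl fun x _ => ?_
  have h : (∀ y, r x.succ y → x.succ ≤ y) ↔ ∀ y, Setoid.comap Fin.succ r x y → x ≤ y := by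
    rw [Fin.forall_fin_succ]
    refine ⟨fun h y hy => Fin.succ_le_succ_iff.mp (h.2 y hy), fun h => ⟨fun h0 => ?_, fun y hy =>
      Fin.succ_le_succ_iff.mpr (h y hy)⟩⟩
    exact absurd (hr _ (r.symm' h0)) (Fin.succ_ne_zero x)
  simp only [h, hr.classCard_succ_eq, ite_self, add_zero]

theorem ZeroSingleton.intervalRel_succ_succ {n : ℕ} {r : Setoid (Fin (n + 1))}
    (hr : ZeroSingleton r) (x y : Fin n) :
    intervalRel r x.succ y.succ ↔ intervalRel (Setoid.comap Fin.succ r) x y := by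
  constructor
  · intro h u v huv
    have := h u.succ v.succ huv
    simpa only [Fin.succ_lt_succ_iff] using this
  · intro h u v huv
    induction u using Fin.cases with
    | zero => rw [hr v huv]
    | succ u =>
      induction v using Fin.cases with
      | zero => rw [hr _ (r.symm' huv)]
      | succ v =>
        have := h u v huv
        simpa only [Fin.succ_lt_succ_iff] using this

/-- Everything after the singleton 0 is a union of classes, so the complement joins the first point
to the last. -/
theorem ZeroSingleton.intervalRel_zero_last {n : ℕ} {r : Setoid (Fin (n + 1))}
    (hr : ZeroSingleton r) : intervalRel r 0 (Fin.last n) := by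
  intro u v huv
  have h1 : u = 0 → v = 0 := by rintro rfl; exact hr v huv
  have h2 : v = 0 → u = 0 := by rintro rfl; exact hr u (r.symm' huv)
  have h3 := Fin.le_last u
  have h4 := Fin.le_last v
  have h5 : 0 < u ↔ 0 < v := by
    rw [Fin.pos_iff_ne_zero, Fin.pos_iff_ne_zero]
    tauto
  have h6 : ¬ Fin.last n < u := not_lt.mpr h3
  have h7 : ¬ Fin.last n < v := not_lt.mpr h4
  tauto

/-- Deleting the singleton 0 removes one point from the complement, and that point belongs to the
class of the last point; the increment of `j` compensates. At least one further point must remain,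
whence `n + 2`. -/
theorem ZeroSingleton.maxWeight_intervalRel {n : ℕ} {r : Setoid (Fin (n + 2))}
    (hr : ZeroSingleton r) (u : ℕ → ℂ) (j : ℕ) :
    maxWeight u j (intervalRel r) =
      maxWeight u (j + 1) (intervalRel (Setoid.comap Fin.succ r)) := by
  classical
  rw [maxWeight, Fin.prod_univ_succ, if_neg, one_mul, maxWeight]
  · refine Finset.prod_congr rfl fun x _ => ?_
    have h : (∀ y, intervalRel r x.succ y → y ≤ x.succ) ↔
        ∀ y, intervalRel (Setoid.comap Fin.succ r) x y → y ≤ x := by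
      rw [Fin.forall_fin_succ]
      simp only [hr.intervalRel_succ_succ, Fin.succ_le_succ_iff, Fin.zero_le, implies_true,
        true_and]
    have hl : (Fin.last n).succ = Fin.last (n + 1) := Fin.succ_last n
    have h0 : intervalRel r x.succ 0 ↔
        intervalRel (Setoid.comap Fin.succ r) x (Fin.last n) := by
      rw [← hr.intervalRel_succ_succ, hl]
      exact ⟨fun h => Setoid.trans' _ h hr.intervalRel_zero_last,
        fun h => Setoid.trans' _ h (Setoid.symm' _ hr.intervalRel_zero_last)⟩
    have hc : classCard (intervalRel r) x.succ = (if intervalRel (Setoid.comap Fin.succ r) x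
        (Fin.last n) then 1 else 0) + classCard (intervalRel (Setoid.comap Fin.succ r)) x := by
      rw [classCard_succ, classCard]
      simp only [h0, hr.intervalRel_succ_succ]
    simp only [h]
    refine if_ctx_congr Iff.rfl (fun hx => ?_) fun _ => rfl
    have hx' : intervalRel (Setoid.comap Fin.succ r) x (Fin.last n) ↔ (x : ℕ) + 1 = n + 1 := by
      constructor
      · intro h1
        have := hx _ h1
        rw [Fin.le_def, Fin.val_last] at this
        omega
      · intro h1
        rw [show x = Fin.last n from Fin.ext (by rw [Fin.val_last]; omega)]
    rw [hc]
    simp only [hx', Fin.val_succ]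
    congr 1
    by_cases h1 : (x : ℕ) + 1 = n + 1
    · rw [if_pos h1, if_pos h1, if_pos (by omega)]
      ring
    · rw [if_neg h1, if_neg h1, if_neg (by omega)]
      ring
  · intro h
    have := h _ hr.intervalRel_zero_last
    simp at this

/-! ### Merging two partitions along their first classes -/

/-- The relation `r` on `k + 1 + (m + 1)` points restricts to `L` on the first `k + 1` points, where
`0` is a singleton, to `R` on the others, and relates `0` to the first point of `R`. -/
structure IsMerge {k m : ℕ} (r : Setoid (Fin (k + 1 + (m + 1)))) (L : Setoid (Fin (k + 1)))
    (R : Setoid (Fin (m + 1))) : Prop where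
  zero : ZeroSingleton L
  left : ∀ x y, r (Fin.castAdd (m + 1) x) (Fin.castAdd (m + 1) y) ↔ L x y
  right : ∀ x y, r (Fin.natAdd (k + 1) x) (Fin.natAdd (k + 1) y) ↔ R x y
  mixed : ∀ x y, r (Fin.castAdd (m + 1) x) (Fin.natAdd (k + 1) y) ↔ x = 0 ∧ R 0 y

theorem castAdd_lt_natAdd {a b : ℕ} (x : Fin a) (y : Fin b) :
    Fin.castAdd b x < Fin.natAdd a y := by
  rw [Fin.lt_def, Fin.val_castAdd, Fin.val_natAdd]
  omega

namespace IsMerge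

variable {k m : ℕ} {r : Setoid (Fin (k + 1 + (m + 1)))} {L : Setoid (Fin (k + 1))}
  {R : Setoid (Fin (m + 1))}

theorem mixed' (h : IsMerge r L R) (x : Fin (k + 1)) (y : Fin (m + 1)) :
    r (Fin.natAdd (k + 1) y) (Fin.castAdd (m + 1) x) ↔ x = 0 ∧ R 0 y := by
  rw [← h.mixed, r.comm']

theorem unique {r' : Setoid (Fin (k + 1 + (m + 1)))} (h : IsMerge r L R) (h' : IsMerge r' L R) :
    r = r' := by
  ext x y
  induction x using Fin.addCases <;> induction y using Fin.addCases <;>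
    simp only [h.left, h.right, h.mixed, h.mixed', h'.left, h'.right, h'.mixed, h'.mixed']

theorem nonCrossingRel_iff (h : IsMerge r L R) :
    NonCrossingRel r ↔ NonCrossingRel L ∧ NonCrossingRel R := by
  constructor
  · intro hr
    constructor
    · intro i j k l hij hjk hkl hik hjl
      rw [← h.left] at hik hjl ⊢
      exact hr _ _ _ _ hij hjk hkl hik hjl
    · intro i j k l hij hjk hkl hik hjl
      rw [← h.right] at hik hjl ⊢
      refine hr _ _ _ _ ?_ ?_ ?_ hik hjl <;> simpa
  · rintro ⟨hL, hR⟩ i j p q hij hjp hpq hip hjq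
    have hlt : ∀ (x : Fin (m + 1)) (y : Fin (k + 1)),
        ¬ Fin.natAdd (k + 1) x < Fin.castAdd (m + 1) y := fun x y =>
      (castAdd_lt_natAdd y x).le.not_gt
    induction i using Fin.addCases with
    | left i =>
      induction j using Fin.addCases with
      | left j =>
        have hj : j ≠ 0 := by
          rintro rfl
          simp [Fin.lt_def] at hij
        induction q using Fin.addCases with
        | left q =>
          induction p using Fin.addCases with
          | left p =>
            rw [h.left] at hip hjq ⊢
            exact hL _ _ _ _ hij hjp hpq hip hjq
          | right p => exact absurd hpq (hlt _ _)
        | right q => exact absurd ((h.mixed _ _).mp hjq).1 hj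
      | right j =>
        induction p using Fin.addCases with
        | left p => exact absurd hjp (hlt _ _)
        | right p =>
          induction q using Fin.addCases with
          | left q => exact absurd hpq (hlt _ _)
          | right q =>
            rw [h.mixed] at hip ⊢
            rw [h.right] at hjq
            refine ⟨hip.1, ?_⟩
            -- The point i is 0 and is joined to the first point of `R`, which replaces it. The
            -- crossing then lies within `R`, unless j is that first point itself.
            rcases Fin.eq_zero_or_eq_succ j with rfl | ⟨j', rfl⟩
            · exact R.refl' 0
            · refine hR 0 _ p q (Fin.succ_pos _) ?_ ?_ hip.2 hjq
              · simpa using hjp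
              · simpa using hpq
    | right i =>
      induction j using Fin.addCases with
      | left j => exact absurd hij (hlt _ _)
      | right j =>
        induction p using Fin.addCases with
        | left p => exact absurd hjp (hlt _ _)
        | right p =>
          induction q using Fin.addCases with
          | left q => exact absurd hpq (hlt _ _)
          | right q =>
            rw [h.right] at hip hjq ⊢
            exact hR _ _ _ _ (by simpa using hij) (by simpa using hjp) (by simpa using hpq) hip hjq

theorem intervalRel_left (h : IsMerge r L R) (x y : Fin (k + 1)) :
    intervalRel r (Fin.castAdd (m + 1) x) (Fin.castAdd (m + 1) y) ↔ intervalRel L x y := by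
  constructor
  · intro hr u v huv
    exact hr _ _ ((h.left u v).mpr huv)
  · intro hL u v huv
    have hz : ∀ x : Fin (k + 1), ¬ Fin.castAdd (m + 1) x < Fin.castAdd (m + 1) 0 := by
      intro x
      simp [Fin.lt_def]
    induction u using Fin.addCases <;> induction v using Fin.addCases
    · exact hL _ _ ((h.left _ _).mp huv)
    · rw [((h.mixed _ _).mp huv).1]
      simp only [hz, castAdd_lt_natAdd]
    · rw [((h.mixed' _ _).mp huv).1]
      simp only [hz, castAdd_lt_natAdd]
    · simp only [castAdd_lt_natAdd]

theorem intervalRel_right (h : IsMerge r L R) (x y : Fin (m + 1)) :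
    intervalRel r (Fin.natAdd (k + 1) x) (Fin.natAdd (k + 1) y) ↔ intervalRel R x y := by
  have hlt : ∀ (x : Fin (m + 1)) (y : Fin (k + 1)),
      Fin.natAdd (k + 1) x < Fin.castAdd (m + 1) y ↔ False := fun x y =>
    iff_false_intro (castAdd_lt_natAdd y x).le.not_gt
  have hlt' : ∀ x y : Fin (m + 1), Fin.natAdd (k + 1) x < Fin.natAdd (k + 1) y ↔ x < y :=
    fun x y => by simp
  constructor
  · intro hr u v huv
    have := hr _ _ ((h.right u v).mpr huv)
    simpa only [hlt'] using this
  · intro hR u v huv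
    induction u using Fin.addCases <;> induction v using Fin.addCases
    · simp only [hlt]
    · have := hR _ _ ((h.mixed _ _).mp huv).2
      simp only [Fin.not_lt_zero] at this
      simpa only [hlt, hlt'] using this
    · have := hR _ _ (R.symm' ((h.mixed' _ _).mp huv).2)
      simp only [Fin.not_lt_zero] at this
      simpa only [hlt, hlt'] using this
    · have := hR _ _ ((h.right _ _).mp huv)
      simpa only [hlt'] using this

/-- The points 0 and k + 1 are related, but an interval from a left point to a right point contains
k + 1 and not 0. -/
theorem not_intervalRel_mixed (h : IsMerge r L R) (x : Fin (k + 1)) (y : Fin (m + 1)) :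
    ¬ intervalRel r (Fin.castAdd (m + 1) x) (Fin.natAdd (k + 1) y) := by
  intro hr
  have := hr _ _ ((h.mixed 0 0).mpr ⟨rfl, R.refl' 0⟩)
  have h1 : ¬ Fin.castAdd (m + 1) x < Fin.castAdd (m + 1) 0 := by simp [Fin.lt_def]
  have h2 : ¬ Fin.natAdd (k + 1) y < Fin.castAdd (m + 1) 0 :=
    (castAdd_lt_natAdd _ _).le.not_gt
  have h3 : ¬ Fin.natAdd (k + 1) y < Fin.natAdd (k + 1) 0 := by
    rw [Fin.lt_def, Fin.val_natAdd, Fin.val_natAdd, Fin.val_zero]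
    omega
  have h4 := castAdd_lt_natAdd x (0 : Fin (m + 1))
  tauto

end IsMerge

open Classical in
theorem classCard_add {a b : ℕ} (r : Setoid (Fin (a + b))) (x : Fin (a + b)) :
    classCard r x = (Finset.univ.filter fun y : Fin a => r x (Fin.castAdd b y)).card +
      (Finset.univ.filter fun y : Fin b => r x (Fin.natAdd a y)).card := by
  rw [classCard, Finset.card_filter, Fin.sum_univ_add, Finset.card_filter, Finset.card_filter]

theorem forall_fin_add {a b : ℕ} {P : Fin (a + b) → Prop} :
    (∀ x, P x) ↔ (∀ x, P (Fin.castAdd b x)) ∧ ∀ y, P (Fin.natAdd a y) :=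
  ⟨fun h => ⟨fun _ => h _, fun _ => h _⟩, fun h x => Fin.addCases h.1 h.2 x⟩

namespace IsMerge

variable {k m : ℕ} {r : Setoid (Fin (k + 1 + (m + 1)))} {L : Setoid (Fin (k + 1))}
  {R : Setoid (Fin (m + 1))}

/-- The complement of the merged relation is the disjoint union of the two complements, and the last
point lies in the right part, so only that factor keeps `j`. -/
theorem maxWeight_eq (h : IsMerge r L R) (u : ℕ → ℂ) (j : ℕ) :
    maxWeight u j (intervalRel r) =
      maxWeight u 0 (intervalRel L) * maxWeight u j (intervalRel R) := by
  classical
  have hm' : ∀ x y, ¬ intervalRel r (Fin.natAdd (k + 1) y) (Fin.castAdd (m + 1) x) :=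
    fun x y hr => h.not_intervalRel_mixed x y (Setoid.symm' _ hr)
  rw [maxWeight, Fin.prod_univ_add, maxWeight, maxWeight]
  congr 1
  · refine Finset.prod_congr rfl fun x _ => ?_
    have hc : classCard (intervalRel r) (Fin.castAdd (m + 1) x) =
        classCard (intervalRel L) x := by
      rw [classCard_add, classCard]
      simp only [h.intervalRel_left, h.not_intervalRel_mixed, Finset.filter_false,
        Finset.card_empty, add_zero]
    have hm : (∀ y, intervalRel r (Fin.castAdd (m + 1) x) y → y ≤ Fin.castAdd (m + 1) x) ↔
        ∀ y, intervalRel L x y → y ≤ x := by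
      rw [forall_fin_add]
      simp only [h.intervalRel_left, h.not_intervalRel_mixed, false_imp_iff, implies_true,
        and_true]
      rfl
    have hx : ¬ ((x : ℕ) + 1 = k + 1 + (m + 1)) := by omega
    simp only [hc, hm, Fin.val_castAdd, if_neg hx, ite_self]
  · refine Finset.prod_congr rfl fun x _ => ?_
    have hc : classCard (intervalRel r) (Fin.natAdd (k + 1) x) =
        classCard (intervalRel R) x := by
      rw [classCard_add, classCard]
      simp only [h.intervalRel_right, hm', Finset.filter_false, Finset.card_empty, zero_add]
    have hle : ∀ x y : Fin (m + 1), Fin.natAdd (k + 1) x ≤ Fin.natAdd (k + 1) y ↔ x ≤ y :=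
      fun x y => by simp
    have hm : (∀ y, intervalRel r (Fin.natAdd (k + 1) x) y → y ≤ Fin.natAdd (k + 1) x) ↔
        ∀ y, intervalRel R x y → y ≤ x := by
      rw [forall_fin_add]
      simp only [h.intervalRel_right, hm', false_imp_iff, implies_true, true_and, hle]
    have hx : (k + 1 + (x : ℕ) + 1 = k + 1 + (m + 1)) ↔ (x : ℕ) + 1 = m + 1 := by omega
    simp only [hc, hm, Fin.val_natAdd, hx]

/-- Merging adds the point 0 to the first class of `R`, whence `i + 1`; the other classes of `L` and
`R` keep their sizes. -/
theorem minWeight_eq (h : IsMerge r L R) (u : ℕ → ℂ) (i : ℕ) :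
    minWeight u i r = tailWeight u L * minWeight u (i + 1) R := by
  classical
  have hlt : ∀ (x : Fin (k + 1)) (y : Fin (m + 1)),
      Fin.castAdd (m + 1) x ≤ Fin.natAdd (k + 1) y := fun x y => (castAdd_lt_natAdd x y).le
  have hlt' : ∀ (x : Fin (k + 1)) (y : Fin (m + 1)),
      ¬ Fin.natAdd (k + 1) y ≤ Fin.castAdd (m + 1) x := fun x y => (castAdd_lt_natAdd x y).not_ge
  have hle : ∀ x y : Fin (m + 1), Fin.natAdd (k + 1) x ≤ Fin.natAdd (k + 1) y ↔ x ≤ y :=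
    fun x y => by simp
  have hle' : ∀ x y : Fin (k + 1), Fin.castAdd (m + 1) x ≤ Fin.castAdd (m + 1) y ↔ x ≤ y :=
    fun x y => Iff.rfl
  have hL : ∀ x : Fin k,
      (if ∀ y, r (Fin.castAdd (m + 1) x.succ) y → Fin.castAdd (m + 1) x.succ ≤ y then
        u (classCard r (Fin.castAdd (m + 1) x.succ) +
          if (Fin.castAdd (m + 1) x.succ : ℕ) = 0 then i else 0) else 1) =
      if ∀ y, L x.succ y → x.succ ≤ y then u (classCard L x.succ) else 1 := by
    intro x
    have hc : classCard r (Fin.castAdd (m + 1) x.succ) = classCard L x.succ := by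
      rw [classCard_add, classCard]
      simp [h.left, h.mixed]
    have hm : (∀ y, r (Fin.castAdd (m + 1) x.succ) y → Fin.castAdd (m + 1) x.succ ≤ y) ↔
        ∀ y, L x.succ y → x.succ ≤ y := by
      rw [forall_fin_add]
      simp only [h.left, hle', hlt, implies_true, and_true]
    simp [hc, hm]
  have hR : ∀ x : Fin m,
      (if ∀ y, r (Fin.natAdd (k + 1) x.succ) y → Fin.natAdd (k + 1) x.succ ≤ y then
        u (classCard r (Fin.natAdd (k + 1) x.succ) +
          if (Fin.natAdd (k + 1) x.succ : ℕ) = 0 then i else 0) else 1) =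
      if ∀ y, R x.succ y → x.succ ≤ y then
        u (classCard R x.succ + if (x.succ : ℕ) = 0 then i + 1 else 0) else 1 := by
    intro x
    by_cases h0 : R x.succ 0
    · rw [if_neg, if_neg]
      · intro h1
        exact absurd (h1 0 h0) (Fin.succ_pos x).not_ge
      · intro h1
        exact hlt' _ _ (h1 _ ((h.mixed' 0 x.succ).mpr ⟨rfl, R.symm' h0⟩))
    · have h0' : ¬ R 0 x.succ := fun h => h0 (R.symm' h)
      have hc : classCard r (Fin.natAdd (k + 1) x.succ) = classCard R x.succ := by
        rw [classCard_add, classCard]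
        simp [h.right, h.mixed', h0']
      have hm : (∀ y, r (Fin.natAdd (k + 1) x.succ) y → Fin.natAdd (k + 1) x.succ ≤ y) ↔
          ∀ y, R x.succ y → x.succ ≤ y := by
        rw [forall_fin_add]
        simp only [h.right, h.mixed', h0', hle, and_false, false_imp_iff, implies_true, true_and]
      simp [hc, hm]
  have hc : classCard r (Fin.castAdd (m + 1) 0) = 1 + classCard R 0 := by
    refine (classCard_add r _).trans (congrArg₂ (· + ·) ?_ ?_)
    · refine Eq.trans ?_ h.zero.classCard_zero
      rw [classCard]
      simp only [h.left]
    · rw [classCard]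
      simp only [h.mixed, true_and]
  have hzero : (if ∀ y, r (Fin.castAdd (m + 1) 0) y → Fin.castAdd (m + 1) 0 ≤ y then
        u (classCard r (Fin.castAdd (m + 1) 0) +
          if (Fin.castAdd (m + 1) (0 : Fin (k + 1)) : ℕ) = 0 then i else 0) else 1) =
      u (classCard R 0 + (i + 1)) := by
    rw [if_pos fun y _ => by simp [Fin.le_def], if_pos (by simp), hc]
    congr 1
    ring
  -- The first point of `R` is no longer the least of its class; the factor of that class now sits
  -- at 0.
  have hone : (if ∀ y, r (Fin.natAdd (k + 1) 0) y → Fin.natAdd (k + 1) 0 ≤ y then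
        u (classCard r (Fin.natAdd (k + 1) 0) +
          if (Fin.natAdd (k + 1) (0 : Fin (m + 1)) : ℕ) = 0 then i else 0) else 1) = 1 :=
    if_neg fun h1 => hlt' _ _ (h1 _ ((h.mixed' 0 0).mpr ⟨rfl, R.refl' 0⟩))
  have hzero' : (if ∀ y, R 0 y → 0 ≤ y then
        u (classCard R 0 + if ((0 : Fin (m + 1)) : ℕ) = 0 then i + 1 else 0) else 1) =
      u (classCard R 0 + (i + 1)) := by
    rw [if_pos fun y _ => Fin.zero_le y, if_pos (by simp)]
  rw [minWeight, Fin.prod_univ_add, Fin.prod_univ_succ,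
    Finset.prod_congr rfl fun x _ => hL x, Fin.prod_univ_succ (n := m),
    Finset.prod_congr rfl fun x _ => hR x, minWeight, Fin.prod_univ_succ (n := m), tailWeight,
    hzero, hone, hzero']
  ring

end IsMerge

/-- The point of the left or of the right part at which a point of the merged partition sits. -/
def mergeLabel {k m : ℕ} (p : Fin (k + 1 + (m + 1))) : Fin (k + 1) ⊕ Fin (m + 1) :=
  Fin.addCases (motive := fun _ => Fin (k + 1) ⊕ Fin (m + 1))
    (fun x => if x = 0 then Sum.inr 0 else Sum.inl x) Sum.inr p

/-- Merge `L` and `R` along the class of `0`. -/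
def merge {k m : ℕ} (L : Setoid (Fin (k + 1))) (R : Setoid (Fin (m + 1))) :
    Setoid (Fin (k + 1 + (m + 1))) where
  r p q := Sum.LiftRel L R (mergeLabel p) (mergeLabel q)
  iseqv :=
    { refl := fun p => by
        generalize mergeLabel p = s
        cases s
        · exact Sum.LiftRel.inl (L.refl' _)
        · exact Sum.LiftRel.inr (R.refl' _)
      symm := fun {p q} h => by
        revert h
        generalize mergeLabel p = p
        generalize mergeLabel q = q
        rintro (h | h)
        · exact Sum.LiftRel.inl (L.symm' h)
        · exact Sum.LiftRel.inr (R.symm' h)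
      trans := fun {p q s} h h' => by
        revert h h'
        generalize mergeLabel p = p
        generalize mergeLabel q = q
        generalize mergeLabel s = s
        rintro (h | h) (h' | h')
        · exact Sum.LiftRel.inl (L.trans' h h')
        · exact Sum.LiftRel.inr (R.trans' h h') }

theorem isMerge_merge {k m : ℕ} {L : Setoid (Fin (k + 1))} (hL : ZeroSingleton L)
    (R : Setoid (Fin (m + 1))) : IsMerge (merge L R) L R where
  zero := hL
  left x y := by
    have h0 : ∀ y, L 0 y ↔ y = 0 := fun y => ⟨hL y, fun h => h ▸ L.refl' 0⟩
    have h0' : ∀ y, L y 0 ↔ y = 0 := fun y => by rw [L.comm', h0]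
    change Sum.LiftRel _ _ _ _ ↔ _
    rw [mergeLabel, mergeLabel, Fin.addCases_left, Fin.addCases_left]
    by_cases hx : x = 0 <;> by_cases hy : y = 0 <;> simp [hx, hy, h0, h0']
  right x y := by
    change Sum.LiftRel _ _ _ _ ↔ _
    rw [mergeLabel, mergeLabel, Fin.addCases_right, Fin.addCases_right]
    simp
  mixed x y := by
    change Sum.LiftRel _ _ _ _ ↔ _
    rw [mergeLabel, mergeLabel, Fin.addCases_left, Fin.addCases_right]
    by_cases hx : x = 0 <;> simp [hx]

/-- The second point of the class of `0` is `k + 1`. -/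
def SecondPoint (k : ℕ) {n : ℕ} (r : Setoid (Fin (n + 1))) : Prop :=
  (∃ y : Fin (n + 1), (y : ℕ) = k + 1 ∧ r 0 y) ∧ ∀ y : Fin (n + 1), r 0 y → (y : ℕ) ≤ k → y = 0

theorem IsMerge.secondPoint {k m : ℕ} {r : Setoid (Fin (k + 1 + m + 1))}
    {L : Setoid (Fin (k + 1))} {R : Setoid (Fin (m + 1))}
    (h : IsMerge r L R) : SecondPoint k r := by
  have hz : (0 : Fin (k + 1 + m + 1)) = Fin.castAdd (m + 1) (0 : Fin (k + 1)) := by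
    ext; simp
  constructor
  · refine ⟨Fin.natAdd (k + 1) (0 : Fin (m + 1)), by simp, ?_⟩
    rw [hz]
    exact (h.mixed 0 0).mpr ⟨rfl, R.refl' 0⟩
  · intro y hy hk
    have hy' : y = Fin.castAdd (m + 1) (⟨y, by omega⟩ : Fin (k + 1)) := by ext; simp
    rw [hy', hz] at hy
    have := h.zero _ ((h.left _ _).mp hy)
    rw [hy', this, hz]

/-- A link between one of the points 1, …, k and a point beyond k + 1 would cross the link from 0 to
k + 1, and a link to k + 1 would put an earlier point into the class of 0. -/
theorem NonCrossingRel.isMerge {k m : ℕ} {r : Setoid (Fin (k + 1 + m + 1))}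
    (hr : NonCrossingRel r) (hs : SecondPoint k r) :
    IsMerge (k := k) (m := m) r
      (Setoid.comap (Fin.castAdd (m + 1) : Fin (k + 1) → Fin (k + 1 + m + 1)) r)
      (Setoid.comap (Fin.natAdd (k + 1) : Fin (m + 1) → Fin (k + 1 + m + 1)) r) := by
  have hz : Fin.castAdd (m + 1) (0 : Fin (k + 1)) = (0 : Fin (k + 1 + m + 1)) := by
    ext; simp
  obtain ⟨⟨s, hsk, h0s⟩, hgap⟩ := hs
  have hs' : s = Fin.natAdd (k + 1) (0 : Fin (m + 1)) := by ext; simp [hsk]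
  rw [hs'] at h0s
  refine ⟨?_, fun x y => Iff.rfl, fun x y => Iff.rfl, fun x y => ?_⟩
  · intro y hy
    have := hgap (Fin.castAdd (m + 1) y) (hz ▸ hy) (by rw [Fin.val_castAdd]; omega)
    rw [← hz] at this
    exact Fin.castAdd_injective _ _ this
  · constructor
    · intro hxy
      by_cases hx : x = 0
      · refine ⟨hx, ?_⟩
        rw [hx, hz] at hxy
        exact r.trans' (r.symm' h0s) hxy
      · exfalso
        have hne : Fin.castAdd (m + 1) x ≠ 0 := fun h => hx (by
          rw [← hz] at h
          exact Fin.castAdd_injective _ _ h)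
        have h0x : ¬ r 0 (Fin.castAdd (m + 1) x) := fun h =>
          hne (hgap _ h (by rw [Fin.val_castAdd]; omega))
        rcases Fin.eq_zero_or_eq_succ y with rfl | ⟨y', rfl⟩
        · exact h0x (r.trans' h0s (r.symm' hxy))
        · refine h0x (hr 0 _ (Fin.natAdd (k + 1) (0 : Fin (m + 1))) _ ?_ ?_ ?_ h0s hxy)
          · exact Fin.pos_of_ne_zero hne
          · exact castAdd_lt_natAdd _ _
          · rw [Fin.lt_def, Fin.val_natAdd, Fin.val_natAdd, Fin.val_succ, Fin.val_zero]
            omega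
    · rintro ⟨rfl, h⟩
      rw [hz]
      exact r.trans' h0s h

/-! ### Generating series of non-crossing partitions -/

open Classical in
/-- The non-crossing equivalence relations on `Fin n`. -/
noncomputable def ncRel (n : ℕ) : Finset (Setoid (Fin n)) := (NC n).image relOf

theorem mem_ncRel {n : ℕ} {r : Setoid (Fin n)} : r ∈ ncRel n ↔ NonCrossingRel r := by
  classical
  rw [ncRel, Finset.mem_image]
  constructor
  · rintro ⟨π, hπ, rfl⟩
    exact mem_NC_iff.mp hπ
  · intro h
    refine ⟨Finpartition.ofSetoid r, ?_, relOf_ofSetoid r⟩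
    rw [mem_NC_iff, relOf_ofSetoid]
    exact h

theorem sum_NC_eq_sum_ncRel {n : ℕ} (F : Setoid (Fin n) → ℂ) :
    ∑ π ∈ NC n, F (relOf π) = ∑ r ∈ ncRel n, F r := by
  classical
  rw [ncRel, Finset.sum_image fun π _ ρ _ h => relOf_injective h]

/-- The sum of `u_π v_{Kr π}` over the non-crossing partitions of `n` points, where the class of the
first point in `π` counts for `i` more elements, and that of the last point in `Kr π` for `j`. -/
noncomputable def ncWeight (u v : ℕ → ℂ) (i j n : ℕ) : ℂ :=
  ∑ r ∈ ncRel n, minWeight u i r * maxWeight v j (intervalRel r)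

open Classical in
/-- The sum over the non-crossing partitions of `n + 1` points that have the singleton `0`, which
is left out of the product. -/
noncomputable def singletonWeight (u v : ℕ → ℂ) (j n : ℕ) : ℂ :=
  ∑ r ∈ (ncRel (n + 1)).filter ZeroSingleton, tailWeight u r * maxWeight v j (intervalRel r)

theorem sum_blockProd_kreweras (u v : ℕ → ℂ) (n : ℕ) :
    ∑ π ∈ NC n, blockProd u π * blockProd v (kreweras π) = ncWeight u v 0 0 n := by
  rw [ncWeight, ← sum_NC_eq_sum_ncRel]
  refine Finset.sum_congr rfl fun π hπ => ?_
  rw [blockProd_eq_minWeight, blockProd_eq_maxWeight, relOf_kreweras hπ]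

theorem singletonWeight_zero (u v : ℕ → ℂ) (j : ℕ) : singletonWeight u v j 0 = v (1 + j) := by
  classical
  have hsub : Subsingleton (Fin (0 + 1)) := inferInstanceAs (Subsingleton (Fin 1))
  have h1 : ∀ r : Setoid (Fin (0 + 1)), r = ⊤ := fun r => by
    ext x y
    rw [Subsingleton.elim x y]
    exact ⟨fun _ => Setoid.refl' _ _, fun _ => r.refl' _⟩
  have h2 : (ncRel (0 + 1)).filter ZeroSingleton = {⊤} := by
    ext r
    rw [Finset.mem_filter, Finset.mem_singleton, mem_ncRel]
    refine ⟨fun _ => h1 r, fun _ => ⟨fun i j k l hij => ?_, fun y _ => Subsingleton.elim _ _⟩⟩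
    exact absurd hij (by rw [Subsingleton.elim i j]; exact lt_irrefl _)
  rw [singletonWeight, h2, Finset.sum_singleton, h1 (intervalRel ⊤), maxWeight, tailWeight]
  have h3 : classCard (⊤ : Setoid (Fin (0 + 1))) 0 = 1 := by
    rw [classCard, Finset.filter_true_of_mem fun _ _ => Setoid.top_def ▸ trivial]
    simp
  simp [h3]

/-- Deleting and adjoining the singleton 0 are inverse bijections, and the lost point of the
complement raises `j` by one. The case of a single point is the separate base case
`singletonWeight_zero`. -/
theorem singletonWeight_succ (u v : ℕ → ℂ) (j n : ℕ) :
    singletonWeight u v j (n + 1) = ncWeight u v 0 (j + 1) (n + 1) := by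
  classical
  rw [singletonWeight, ncWeight]
  refine Finset.sum_bij' (fun r _ => Setoid.comap Fin.succ r) (fun t _ => adjoinZero t) ?_ ?_ ?_ ?_ ?_
  · intro r hr
    obtain ⟨h1, h2⟩ := Finset.mem_filter.mp hr
    exact mem_ncRel.mpr (h2.nonCrossingRel_iff.mp (mem_ncRel.mp h1))
  · intro t ht
    have := zeroSingleton_adjoinZero t
    rw [Finset.mem_filter, mem_ncRel, this.nonCrossingRel_iff, comap_succ_adjoinZero]
    exact ⟨mem_ncRel.mp ht, this⟩
  · intro r hr
    exact (Finset.mem_filter.mp hr).2.eq_adjoinZero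
  · intro t _
    exact comap_succ_adjoinZero t
  · intro r hr
    have h := (Finset.mem_filter.mp hr).2
    rw [h.tailWeight_eq, h.maxWeight_intervalRel]

open Classical in
theorem sum_zeroSingleton (u v : ℕ → ℂ) (i j n : ℕ) :
    ∑ r ∈ (ncRel (n + 1)).filter ZeroSingleton, minWeight u i r * maxWeight v j (intervalRel r) =
      u (1 + i) * singletonWeight u v j n := by
  rw [singletonWeight, Finset.mul_sum]
  refine Finset.sum_congr rfl fun r hr => ?_
  rw [(Finset.mem_filter.mp hr).2.minWeight_eq, mul_assoc]

open Classical in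
-- Cutting just before k + 1 is inverse to `merge`. The left piece has 0 as a singleton, the right
-- piece is arbitrary, and both weights are multiplicative.
theorem sum_secondPoint_add (u v : ℕ → ℂ) (i j k m : ℕ) :
    ∑ r ∈ (ncRel (k + 1 + m + 1)).filter (SecondPoint k),
        minWeight u i r * maxWeight v j (intervalRel r) =
      singletonWeight u v 0 k * ncWeight u v (i + 1) j (m + 1) := by
  rw [singletonWeight, ncWeight, Finset.sum_mul_sum, ← Finset.sum_product']
  refine Finset.sum_bij'
    (fun r _ => (Setoid.comap (Fin.castAdd (m + 1) : Fin (k + 1) → Fin (k + 1 + m + 1)) r,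
      Setoid.comap (Fin.natAdd (k + 1) : Fin (m + 1) → Fin (k + 1 + m + 1)) r))
    (fun p _ => merge p.1 p.2) ?_ ?_ ?_ ?_ ?_
  · intro r hr
    obtain ⟨h1, h2⟩ := Finset.mem_filter.mp hr
    have h := (mem_ncRel.mp h1).isMerge h2
    have h3 := h.nonCrossingRel_iff.mp (mem_ncRel.mp h1)
    exact Finset.mem_product.mpr ⟨Finset.mem_filter.mpr ⟨mem_ncRel.mpr h3.1, h.zero⟩,
      mem_ncRel.mpr h3.2⟩
  · intro p hp
    obtain ⟨h1, h2⟩ := Finset.mem_product.mp hp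
    obtain ⟨h3, h4⟩ := Finset.mem_filter.mp h1
    have h := isMerge_merge h4 p.2
    exact Finset.mem_filter.mpr ⟨mem_ncRel.mpr (h.nonCrossingRel_iff.mpr
      ⟨mem_ncRel.mp h3, mem_ncRel.mp h2⟩), h.secondPoint⟩
  · intro r hr
    obtain ⟨h1, h2⟩ := Finset.mem_filter.mp hr
    have h := (mem_ncRel.mp h1).isMerge h2
    exact (isMerge_merge h.zero _).unique h
  · intro p hp
    obtain ⟨h1, h2⟩ := Finset.mem_product.mp hp
    have h := isMerge_merge (Finset.mem_filter.mp h1).2 p.2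
    refine Prod.ext ?_ ?_
    · ext x y
      exact h.left x y
    · ext x y
      exact h.right x y
  · intro r hr
    obtain ⟨h1, h2⟩ := Finset.mem_filter.mp hr
    have h := (mem_ncRel.mp h1).isMerge h2
    rw [h.minWeight_eq (k := k) (m := m), h.maxWeight_eq (k := k) (m := m)]
    ring

open Classical in
theorem sum_secondPoint (u v : ℕ → ℂ) (i j : ℕ) {k n : ℕ} (hk : k < n) :
    ∑ r ∈ (ncRel (n + 1)).filter (SecondPoint k),
        minWeight u i r * maxWeight v j (intervalRel r) =
      singletonWeight u v 0 k * ncWeight u v (i + 1) j (n - k) := by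
  obtain ⟨m, rfl⟩ := Nat.exists_eq_add_of_lt hk
  rw [show k + m + 1 - k = m + 1 by omega, show k + m + 1 = k + 1 + m by ring]
  exact sum_secondPoint_add u v i j k m

theorem exists_secondPoint {n : ℕ} {r : Setoid (Fin (n + 1))} (hr : ¬ ZeroSingleton r) :
    ∃ k < n, SecondPoint k r := by
  classical
  have h : ∃ k, ∃ y : Fin (n + 1), (y : ℕ) = k + 1 ∧ r 0 y := by
    simp only [ZeroSingleton, not_forall] at hr
    obtain ⟨y, hy, hy0⟩ := hr
    obtain ⟨y', rfl⟩ := Fin.exists_succ_eq.mpr hy0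
    exact ⟨y', y'.succ, by simp, hy⟩
  refine ⟨Nat.find h, ?_, Nat.find_spec h, fun y hy hle => ?_⟩
  · obtain ⟨y, hy, _⟩ := Nat.find_spec h
    omega
  · by_contra hy0
    obtain ⟨y', rfl⟩ := Fin.exists_succ_eq.mpr hy0
    have := Nat.find_min' h ⟨y'.succ, Fin.val_succ y', hy⟩
    rw [Fin.val_succ] at hle
    omega

theorem SecondPoint.eq {n k l : ℕ} {r : Setoid (Fin (n + 1))} (h : SecondPoint k r)
    (h' : SecondPoint l r) : k = l := by
  obtain ⟨⟨y, hy, hry⟩, hk⟩ := h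
  obtain ⟨⟨z, hz, hrz⟩, hl⟩ := h'
  by_contra hne
  rcases Nat.lt_or_gt_of_ne hne with hlt | hlt
  · have := hl y hry (by omega)
    rw [this, Fin.val_zero] at hy
    omega
  · have := hk z hrz (by omega)
    rw [this, Fin.val_zero] at hz
    omega

theorem SecondPoint.not_zeroSingleton {n k : ℕ} {r : Setoid (Fin (n + 1))}
    (h : SecondPoint k r) : ¬ ZeroSingleton r := by
  intro h0
  obtain ⟨⟨y, hy, hry⟩, -⟩ := h
  rw [h0 y hry, Fin.val_zero] at hy
  omega

/-- Either 0 is a singleton or its class has a second point k + 1; these cases are disjoint and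
exhaustive. -/
theorem ncWeight_succ (u v : ℕ → ℂ) (i j n : ℕ) :
    ncWeight u v i j (n + 1) = u (1 + i) * singletonWeight u v j n +
      ∑ k ∈ Finset.range n, singletonWeight u v 0 k * ncWeight u v (i + 1) j (n - k) := by
  classical
  rw [ncWeight, ← Finset.sum_filter_add_sum_filter_not _ ZeroSingleton, sum_zeroSingleton]
  congr 1
  have h : (ncRel (n + 1)).filter (fun r => ¬ ZeroSingleton r) =
      (Finset.range n).biUnion fun k => (ncRel (n + 1)).filter (SecondPoint k) := by
    ext r
    simp only [Finset.mem_filter, Finset.mem_biUnion, Finset.mem_range]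
    constructor
    · rintro ⟨h1, h2⟩
      obtain ⟨k, hk, h3⟩ := exists_secondPoint h2
      exact ⟨k, hk, h1, h3⟩
    · rintro ⟨k, _, h1, h2⟩
      exact ⟨h1, h2.not_zeroSingleton⟩
  rw [h, Finset.sum_biUnion]
  · exact Finset.sum_congr rfl fun k hk => sum_secondPoint u v i j (Finset.mem_range.mp hk)
  · intro k _ l _ hkl
    rw [Function.onFun, Finset.disjoint_left]
    intro r hr hr'
    exact hkl ((Finset.mem_filter.mp hr).2.eq (Finset.mem_filter.mp hr').2)

/-! ### Functional equations of the generating series -/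

/-- The series of non-crossing partitions with a marked singleton. -/
noncomputable def singletonSeries (u v : ℕ → ℂ) (j : ℕ) : PowerSeries ℂ :=
  PowerSeries.mk (singletonWeight u v j)

/-- The series of non-crossing partitions of at least one point. -/
noncomputable def ncSeries (u v : ℕ → ℂ) (i j : ℕ) : PowerSeries ℂ :=
  PowerSeries.mk fun n => ncWeight u v i j (n + 1)

theorem ncSeries_rec (u v : ℕ → ℂ) (i j : ℕ) :
    ncSeries u v i j = PowerSeries.C (u (i + 1)) * singletonSeries u v j +
      PowerSeries.X * singletonSeries u v 0 * ncSeries u v (i + 1) j := by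
  ext n
  rw [map_add, PowerSeries.coeff_C_mul, ncSeries, PowerSeries.coeff_mk, ncWeight_succ,
    singletonSeries, PowerSeries.coeff_mk, add_comm i 1, mul_assoc]
  congr 1
  cases n with
  | zero => simp
  | succ n =>
    rw [PowerSeries.coeff_succ_X_mul, PowerSeries.coeff_mul,
      Finset.Nat.sum_antidiagonal_eq_sum_range_succ_mk]
    refine Finset.sum_congr rfl fun k hk => ?_
    have hk' := Finset.mem_range.mp hk
    rw [singletonSeries, ncSeries, PowerSeries.coeff_mk, PowerSeries.coeff_mk, Nat.add_comm 1 i,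
      show n + 1 - k = n - k + 1 by omega]

theorem singletonSeries_rec (u v : ℕ → ℂ) (j : ℕ) :
    singletonSeries u v j = PowerSeries.C (v (j + 1)) * 1 +
      PowerSeries.X * ncSeries u v 0 (j + 1) := by
  ext n
  cases n with
  | zero => simp [singletonSeries, singletonWeight_zero, add_comm]
  | succ n =>
    rw [map_add, PowerSeries.coeff_succ_X_mul, singletonSeries, PowerSeries.coeff_mk,
      singletonWeight_succ, ncSeries, PowerSeries.coeff_mk]
    simp

theorem ncSeries_zero_left (u v : ℕ → ℂ) (j : ℕ) :
    ncSeries u v 0 j = singletonSeries u v j *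
      compose (fun m => u (m + 1)) (PowerSeries.X * singletonSeries u v 0) :=
  eq_mul_compose_of_rec (by simp) (φ := fun i => ncSeries u v i j) fun i => ncSeries_rec u v i j

/-- Write S_j and N_{i,j} for the two families of series, and take x = z S_0 and y = z f(x).
Unrolling the recursion in i gives N_{0,j} = S_j f(x). Then S_j = v_{j+1} + y S_{j+1}, and unrolling
in j gives S_0 = g(y), so x = z g(y). Finally z N_{0,0} = x f(x). -/
theorem exists_isTreeSystem (u v : ℕ → ℂ) :
    ∃ x y, IsTreeSystem (fun m => u (m + 1)) (fun m => v (m + 1)) x y ∧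
      PowerSeries.coeff 1 x = v 1 ∧ ∀ n, ncWeight u v 0 0 (n + 1) =
        ∑ m ∈ Finset.range (n + 1), u (m + 1) * PowerSeries.coeff (n + 1) (x ^ (m + 1)) := by
  set x := PowerSeries.X * singletonSeries u v 0 with hx
  set y := PowerSeries.X * compose (fun m => u (m + 1)) x with hy
  have hx0 : PowerSeries.constantCoeff x = 0 := by simp [hx]
  have hy0 : PowerSeries.constantCoeff y = 0 := by simp [hy]
  refine ⟨x, y, ⟨?_, rfl⟩, ?_, fun n => ?_⟩
  · have h : singletonSeries u v 0 = 1 * compose (fun m => v (m + 1)) y :=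
      eq_mul_compose_of_rec hy0 (φ := singletonSeries u v) fun j => by
        rw [singletonSeries_rec, ncSeries_zero_left, hy]
        ring
    rw [hx, h, one_mul]
  · rw [hx, ← zero_add 1, PowerSeries.coeff_succ_X_mul, singletonSeries, PowerSeries.coeff_mk,
      singletonWeight_zero]
  · have h1 : ncWeight u v 0 0 (n + 1) =
        PowerSeries.coeff (n + 1) (x * compose (fun m => u (m + 1)) x) := by
      rw [hx, mul_assoc, PowerSeries.coeff_succ_X_mul, ← ncSeries_zero_left, ncSeries,
        PowerSeries.coeff_mk]
    have h2 : x * x ^ (n + 1) = 1 * x ^ (n + 2) := by ring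
    rw [h1, coeff_mul_compose hx0, Finset.sum_range_succ, h2,
      coeff_mul_pow_of_lt hx0 1 (Nat.lt_succ_self _), mul_zero, add_zero]
    simp only [pow_succ']

/-! ### Power series attached to polynomials -/

/-- The series `∏ (1 - λ z)` over the roots `λ` of a monic polynomial. -/
noncomputable def reverseSeries (p : ℂ[X]) : PowerSeries ℂ := (p.reverse : PowerSeries ℂ)

theorem coeff_reverseSeries_of_le {p : ℂ[X]} {d k : ℕ} (hp : p.natDegree = d) (hk : k ≤ d) :
    PowerSeries.coeff k (reverseSeries p) = p.coeff (d - k) := by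
  rw [reverseSeries, Polynomial.coeff_coe, Polynomial.coeff_reverse, hp, Polynomial.revAt_le hk]

theorem coeff_reverseSeries_of_lt {p : ℂ[X]} {d k : ℕ} (hp : p.natDegree = d) (hk : d < k) :
    PowerSeries.coeff k (reverseSeries p) = 0 := by
  rw [reverseSeries, Polynomial.coeff_coe, Polynomial.coeff_reverse, hp,
    Polynomial.revAt_eq_self_of_lt hk]
  exact Polynomial.coeff_eq_zero_of_natDegree_lt (hp ▸ hk)

theorem constantCoeff_reverseSeries {p : ℂ[X]} (hp : p.Monic) :
    PowerSeries.constantCoeff (reverseSeries p) = 1 := by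
  rw [← PowerSeries.coeff_zero_eq_constantCoeff_apply, coeff_reverseSeries_of_le rfl (Nat.zero_le _)]
  exact hp

theorem reverseSeries_mul (p q : ℂ[X]) :
    reverseSeries (p * q) = reverseSeries p * reverseSeries q := by
  rw [reverseSeries, Polynomial.reverse_mul_of_domain, Polynomial.coe_mul]; rfl

theorem reverseSeries_X_sub_C (z : ℂ) :
    reverseSeries (X - C z) = 1 - PowerSeries.C z * PowerSeries.X := by
  have hd := Polynomial.natDegree_X_sub_C z
  ext k
  rcases k with - | - | k
  · rw [coeff_reverseSeries_of_le hd (by omega)]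
    simp
  · rw [coeff_reverseSeries_of_le hd (by omega)]
    simp [PowerSeries.coeff_one]
  · rw [coeff_reverseSeries_of_lt hd (by omega)]
    simp [PowerSeries.coeff_one]

/-- Each factor 1 - λz has logarithmic derivative -λ/(1 - λz), a geometric series, so the product
generates the negated power sums. -/
theorem derivative_reverseSeries_prod (s : Multiset ℂ) :
    PowerSeries.derivative ℂ (reverseSeries (s.map fun z => X - C z).prod) =
      -(PowerSeries.mk fun n => (s.map fun z => z ^ (n + 1)).sum) *
        reverseSeries (s.map fun z => X - C z).prod := by
  induction s using Multiset.induction_on with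
  | empty =>
    have h : (PowerSeries.mk fun n => ((0 : Multiset ℂ).map fun z => z ^ (n + 1)).sum) = 0 := by
      ext n
      simp
    have h1 : reverseSeries 1 = 1 := by
      rw [reverseSeries, ← Polynomial.C_1, Polynomial.reverse_C]
      simp
    rw [h, Multiset.map_zero, Multiset.prod_zero, h1, neg_zero, zero_mul]
    exact Derivation.map_one_eq_zero _
  | cons z s ih =>
    have h : (PowerSeries.mk fun n => ((z ::ₘ s).map fun z => z ^ (n + 1)).sum) =
        PowerSeries.mk (fun n => z ^ (n + 1)) +
          PowerSeries.mk fun n => (s.map fun z => z ^ (n + 1)).sum := by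
      ext n
      simp
    have hgeom : PowerSeries.mk (fun n => z ^ (n + 1)) * (1 - PowerSeries.C z * PowerSeries.X) =
        PowerSeries.C z := by
      ext n
      rw [mul_sub, mul_one, mul_left_comm, map_sub, PowerSeries.coeff_C_mul, PowerSeries.coeff_mk]
      cases n with
      | zero => simp
      | succ n =>
        rw [PowerSeries.coeff_succ_mul_X, PowerSeries.coeff_mk]
        simp
        ring
    have hder : PowerSeries.derivative ℂ (1 - PowerSeries.C z * PowerSeries.X : PowerSeries ℂ) =
        -PowerSeries.C z := by
      rw [map_sub, Derivation.map_one_eq_zero, Derivation.leibniz, PowerSeries.derivative_X,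
        PowerSeries.derivative_C]
      simp
    rw [h, Multiset.map_cons, Multiset.prod_cons, reverseSeries_mul, reverseSeries_X_sub_C,
      Derivation.leibniz, smul_eq_mul, smul_eq_mul, ih, hder]
    linear_combination (reverseSeries (s.map fun z => X - C z).prod) * hgeom

/-- The choice D = -d cancels the sign and averages the power sums; differentiation shifts the index
to n + 1. -/
theorem coeff_scaledLogDeriv_reverseSeries {p : ℂ[X]} {d : ℕ} (hd : 1 ≤ d) (hp : p.Monic)
    (hpd : p.natDegree = d) (n : ℕ) :
    PowerSeries.coeff n (scaledLogDeriv (-d : ℂ) (reverseSeries p)) = rootMoment p (n + 1) := by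
  have hd0 : (d : ℂ) ≠ 0 := Nat.cast_ne_zero.mpr (by omega)
  have hprod : (p.roots.map fun z => X - C z).prod = p :=
    (IsAlgClosed.splits p).eq_prod_roots_of_monic hp |>.symm
  have h1 := derivative_reverseSeries_prod p.roots
  rw [hprod] at h1
  have h2 : scaledLogDeriv (-d : ℂ) (reverseSeries p) =
      PowerSeries.C (d : ℂ)⁻¹ * PowerSeries.mk fun n => (p.roots.map fun z => z ^ (n + 1)).sum := by
    refine scaledLogDeriv_eq_of_derivative_eq (neg_ne_zero.mpr hd0)
      (constantCoeff_reverseSeries hp) ?_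
    rw [h1, ← mul_assoc, ← map_mul, neg_mul (d : ℂ), mul_inv_cancel₀ hd0, map_neg, map_one,
      neg_one_mul]
  rw [h2, PowerSeries.coeff_C_mul, PowerSeries.coeff_mk, rootMoment, hpd]
  ring

/-! ### The finite free convolution as a Hadamard product -/

theorem coeff_finiteFreeMul {d k : ℕ} (p q : ℂ[X]) (hk : k ≤ d) :
    (finiteFreeMul d p q).coeff (d - k) =
      (-1) ^ k * (signedCoeff d p k * signedCoeff d q k / (d.choose k : ℂ)) := by
  rw [finiteFreeMul, Polynomial.finsetSum_coeff,
    Finset.sum_eq_single_of_mem k (Finset.mem_range.mpr (by omega))]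
  · rw [Polynomial.coeff_C_mul, Polynomial.coeff_X_pow, if_pos rfl, mul_one]
  · intro l hl hlk
    have := Finset.mem_range.mp hl
    rw [Polynomial.coeff_C_mul, Polynomial.coeff_X_pow, if_neg (by omega), mul_zero]

theorem natDegree_finiteFreeMul_le (d : ℕ) (p q : ℂ[X]) : (finiteFreeMul d p q).natDegree ≤ d := by
  refine Polynomial.natDegree_sum_le_of_forall_le _ _ fun k _ => ?_
  exact (Polynomial.natDegree_C_mul_X_pow_le _ _).trans (Nat.sub_le d k)

theorem monic_finiteFreeMul {d : ℕ} {p q : ℂ[X]} (hp : p.Monic ∧ p.natDegree = d)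
    (hq : q.Monic ∧ q.natDegree = d) :
    (finiteFreeMul d p q).Monic ∧ (finiteFreeMul d p q).natDegree = d := by
  have hcoeff : (finiteFreeMul d p q).coeff d = 1 := by
    have hp1 : p.coeff d = 1 := hp.2 ▸ hp.1
    have hq1 : q.coeff d = 1 := hq.2 ▸ hq.1
    have := coeff_finiteFreeMul p q (Nat.zero_le d)
    simpa [signedCoeff, hp1, hq1] using this
  have hle := natDegree_finiteFreeMul_le d p q
  exact ⟨Polynomial.monic_of_natDegree_le_of_coeff_eq_one d hle hcoeff,
    le_antisymm hle (Polynomial.le_natDegree_of_ne_zero (by rw [hcoeff]; exact one_ne_zero))⟩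

theorem coeff_reverseSeries_finiteFreeMul {d : ℕ} {p q : ℂ[X]} (hp : p.Monic ∧ p.natDegree = d)
    (hq : q.Monic ∧ q.natDegree = d) (k : ℕ) :
    PowerSeries.coeff k (reverseSeries (finiteFreeMul d p q)) =
      (-1) ^ k * (PowerSeries.coeff k (reverseSeries p) *
        PowerSeries.coeff k (reverseSeries q) / (d.choose k : ℂ)) := by
  have hr := (monic_finiteFreeMul hp hq).2
  rcases le_or_gt k d with hk | hk
  · rw [coeff_reverseSeries_of_le hr hk, coeff_reverseSeries_of_le hp.2 hk,
      coeff_reverseSeries_of_le hq.2 hk, coeff_finiteFreeMul p q hk, signedCoeff, signedCoeff,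
      mul_mul_mul_comm, ← mul_pow]
    norm_num
  -- Beyond the degree the binomial coefficient is 0, but the numerator vanishes as well.
  · rw [coeff_reverseSeries_of_lt hr hk, coeff_reverseSeries_of_lt hp.2 hk]
    simp

/-- The series whose scaled logarithmic derivative carries the finite free cumulants. -/
noncomputable def cumulantSeries (d : ℕ) (p : ℂ[X]) : PowerSeries ℂ :=
  PowerSeries.mk fun k => (d : ℂ) ^ k * PowerSeries.coeff k (reverseSeries p) /
    ((d.choose k : ℂ) * (k.factorial : ℂ))

theorem constantCoeff_cumulantSeries (d : ℕ) {p : ℂ[X]} (hp : p.Monic) :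
    PowerSeries.constantCoeff (cumulantSeries d p) = 1 := by
  rw [← PowerSeries.coeff_zero_eq_constantCoeff_apply, cumulantSeries, PowerSeries.coeff_mk,
    PowerSeries.coeff_zero_eq_constantCoeff_apply, constantCoeff_reverseSeries hp]
  simp

theorem inv_neg_pow_mul_pow {d : ℕ} (hd : 1 ≤ d) (k : ℕ) :
    ((-d : ℂ)⁻¹) ^ k * (d : ℂ) ^ k = (-1) ^ k := by
  have hd0 : (d : ℂ) ≠ 0 := Nat.cast_ne_zero.mpr (by omega)
  rw [← mul_pow, inv_neg, neg_mul, inv_mul_cancel₀ hd0]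

/-- The factor d^k/k! in `cumulantSeries` cancels the weight k! (-d)^(-k) up to the sign (-1)^k,
leaving the single division by the binomial coefficient that ⊠_d requires. -/
theorem hadamard_cumulantSeries_reverseSeries {d : ℕ} (hd : 1 ≤ d) {p q : ℂ[X]}
    (hp : p.Monic ∧ p.natDegree = d) (hq : q.Monic ∧ q.natDegree = d) :
    hadamard (-d : ℂ) (cumulantSeries d p) (reverseSeries q) =
      reverseSeries (finiteFreeMul d p q) := by
  ext k
  have hk : (k.factorial : ℂ) ≠ 0 := Nat.cast_ne_zero.mpr k.factorial_ne_zero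
  rw [coeff_hadamard, coeff_reverseSeries_finiteFreeMul hp hq, cumulantSeries, PowerSeries.coeff_mk,
    ← inv_neg_pow_mul_pow hd k]
  field_simp

theorem hadamard_cumulantSeries_cumulantSeries {d : ℕ} (hd : 1 ≤ d) {p q : ℂ[X]}
    (hp : p.Monic ∧ p.natDegree = d) (hq : q.Monic ∧ q.natDegree = d) :
    hadamard (-d : ℂ) (cumulantSeries d p) (cumulantSeries d q) =
      cumulantSeries d (finiteFreeMul d p q) := by
  ext k
  have hk : (k.factorial : ℂ) ≠ 0 := Nat.cast_ne_zero.mpr k.factorial_ne_zero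
  rw [coeff_hadamard, cumulantSeries, cumulantSeries, cumulantSeries, PowerSeries.coeff_mk,
    PowerSeries.coeff_mk, PowerSeries.coeff_mk, coeff_reverseSeries_finiteFreeMul hp hq,
    ← inv_neg_pow_mul_pow hd k]
  field_simp

theorem monic_X_sub_one_pow (d : ℕ) :
    ((X - C 1 : ℂ[X]) ^ d).Monic ∧ ((X - C 1 : ℂ[X]) ^ d).natDegree = d :=
  ⟨(Polynomial.monic_X_sub_C 1).pow d, by
    rw [Polynomial.natDegree_pow, Polynomial.natDegree_X_sub_C, mul_one]⟩

/-- The signed coefficients of (x - 1)^d are the binomial coefficients, which cancel the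
denominators of ⊠_d. -/
theorem finiteFreeMul_X_sub_one_pow {d : ℕ} {p : ℂ[X]} (hp : p.natDegree ≤ d) :
    finiteFreeMul d p ((X - C 1) ^ d) = p := by
  ext l
  rcases le_or_gt l d with hl | hl
  · obtain ⟨k, hk, rfl⟩ : ∃ k ≤ d, l = d - k := ⟨d - l, by omega, by omega⟩
    have hc : (d.choose k : ℂ) ≠ 0 := Nat.cast_ne_zero.mpr (Nat.choose_pos hk).ne'
    have hs : ((-1) ^ k * (-1) ^ k : ℂ) = 1 := by rw [← mul_pow]; norm_num
    rw [coeff_finiteFreeMul p _ hk, signedCoeff, signedCoeff, sub_eq_add_neg X, ← map_neg,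
      Polynomial.coeff_X_add_C_pow, Nat.sub_sub_self hk, Nat.choose_symm hk, ← mul_assoc,
      ← mul_assoc, mul_div_assoc, div_self hc]
    linear_combination (p.coeff (d - k)) * ((-1) ^ k * (-1) ^ k + 1) * hs
  · rw [Polynomial.coeff_eq_zero_of_natDegree_lt
      ((natDegree_finiteFreeMul_le _ _ _).trans_lt hl),
      Polynomial.coeff_eq_zero_of_natDegree_lt (hp.trans_lt hl)]

theorem rootMoment_X_sub_one_pow {d : ℕ} (hd : 1 ≤ d) (n : ℕ) :
    rootMoment ((X - C 1) ^ d) n = 1 := by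
  have hd0 : (d : ℂ) ≠ 0 := Nat.cast_ne_zero.mpr (by omega)
  rw [rootMoment, (monic_X_sub_one_pow d).2, Polynomial.roots_pow, Polynomial.roots_X_sub_C]
  rw [Multiset.map_nsmul, Multiset.sum_nsmul]
  simp [hd0]

/-! ### Convergence in moments -/

theorem eventually_neg_natCast_ne_zero : ∀ᶠ d : ℕ in atTop, (-d : ℂ) ≠ 0 := by
  filter_upwards [eventually_ge_atTop 1] with d hd
  exact neg_ne_zero.mpr (Nat.cast_ne_zero.mpr (by omega))

theorem tendsto_inv_neg_natCast : Tendsto (fun d : ℕ => (-d : ℂ)⁻¹) atTop (𝓝 0) := by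
  have := (tendsto_inv_atTop_nhds_zero_nat (𝕜 := ℂ)).neg
  simpa [inv_neg] using this

section Convergence

variable {p q : ℕ → ℂ[X]}

theorem tendsto_hadamard (hp : ∀ d : ℕ, 1 ≤ d → (p d).Monic ∧ (p d).natDegree = d)
    {V : ℕ → PowerSeries ℂ} (hV : ∀ᶠ d in atTop, PowerSeries.constantCoeff (V d) = 1)
    {u v : ℕ → ℂ}
    (hu : ∀ n, Tendsto (fun d : ℕ =>
      PowerSeries.coeff n (scaledLogDeriv (-d : ℂ) (cumulantSeries d (p d)))) atTop
      (𝓝 (u (n + 1))))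
    (hv : ∀ n, Tendsto (fun d : ℕ =>
      PowerSeries.coeff n (scaledLogDeriv (-d : ℂ) (V d))) atTop (𝓝 (v (n + 1)))) (n : ℕ) :
    Tendsto (fun d : ℕ => PowerSeries.coeff n
        (scaledLogDeriv (-d : ℂ) (hadamard (-d : ℂ) (cumulantSeries d (p d)) (V d)))) atTop
      (𝓝 (∑ π ∈ NC (n + 1), blockProd u π * blockProd v (kreweras π))) := by
  obtain ⟨x, y, hxy, -, h⟩ := exists_isTreeSystem u v
  rw [sum_blockProd_kreweras, h]
  refine tendsto_coeff_scaledLogDeriv_hadamard (D := fun d => -d) hxy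
    eventually_neg_natCast_ne_zero tendsto_inv_neg_natCast ?_ hV hu hv n
  filter_upwards [eventually_ge_atTop 1] with d hd
  exact constantCoeff_cumulantSeries d (hp d hd).1

theorem tendsto_rootMoment_finiteFreeMul
    (hp : ∀ d : ℕ, 1 ≤ d → (p d).Monic ∧ (p d).natDegree = d)
    (hq : ∀ d : ℕ, 1 ≤ d → (q d).Monic ∧ (q d).natDegree = d) {u v : ℕ → ℂ}
    (hu : ∀ n, Tendsto (fun d : ℕ =>
      PowerSeries.coeff n (scaledLogDeriv (-d : ℂ) (cumulantSeries d (p d)))) atTop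
      (𝓝 (u (n + 1))))
    (hv : ∀ n, Tendsto (fun d : ℕ => rootMoment (q d) (n + 1)) atTop (𝓝 (v (n + 1)))) (n : ℕ) :
    Tendsto (fun d : ℕ => rootMoment (finiteFreeMul d (p d) (q d)) (n + 1)) atTop
      (𝓝 (∑ π ∈ NC (n + 1), blockProd u π * blockProd v (kreweras π))) := by
  refine (tendsto_hadamard (V := fun d => reverseSeries (q d)) hp ?_ hu ?_ n).congr' ?_
  · filter_upwards [eventually_ge_atTop 1] with d hd
    exact constantCoeff_reverseSeries (hq d hd).1
  · intro n
    refine (hv n).congr' ?_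
    filter_upwards [eventually_ge_atTop 1] with d hd
    rw [coeff_scaledLogDeriv_reverseSeries hd (hq d hd).1 (hq d hd).2]
  · filter_upwards [eventually_ge_atTop 1] with d hd
    have hr := monic_finiteFreeMul (hp d hd) (hq d hd)
    rw [hadamard_cumulantSeries_reverseSeries hd (hp d hd) (hq d hd),
      coeff_scaledLogDeriv_reverseSeries hd hr.1 hr.2]

/-- The same limit theorem with a cumulant series in place of the root series as second factor:
finite cumulants combine by the law that defines the cumulants of ⊠. -/
theorem tendsto_cumulant_finiteFreeMul
    (hp : ∀ d : ℕ, 1 ≤ d → (p d).Monic ∧ (p d).natDegree = d)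
    (hq : ∀ d : ℕ, 1 ≤ d → (q d).Monic ∧ (q d).natDegree = d) {u v : ℕ → ℂ}
    (hu : ∀ n, Tendsto (fun d : ℕ =>
      PowerSeries.coeff n (scaledLogDeriv (-d : ℂ) (cumulantSeries d (p d)))) atTop
      (𝓝 (u (n + 1))))
    (hv : ∀ n, Tendsto (fun d : ℕ =>
      PowerSeries.coeff n (scaledLogDeriv (-d : ℂ) (cumulantSeries d (q d)))) atTop
      (𝓝 (v (n + 1)))) (n : ℕ) :
    Tendsto (fun d : ℕ => PowerSeries.coeff n
        (scaledLogDeriv (-d : ℂ) (cumulantSeries d (finiteFreeMul d (p d) (q d))))) atTop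
      (𝓝 (∑ π ∈ NC (n + 1), blockProd u π * blockProd v (kreweras π))) := by
  refine (tendsto_hadamard (V := fun d => cumulantSeries d (q d)) hp ?_ hu hv n).congr' ?_
  · filter_upwards [eventually_ge_atTop 1] with d hd
    exact constantCoeff_cumulantSeries d (hq d hd).1
  · filter_upwards [eventually_ge_atTop 1] with d hd
    rw [hadamard_cumulantSeries_cumulantSeries hd (hp d hd) (hq d hd)]

theorem sum_blockProd_mul_one (u : ℕ → ℂ) (n : ℕ) :
    ∑ π ∈ NC n, blockProd u π * blockProd (fun _ => 1) (kreweras π) =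
      ∑ π ∈ NC n, blockProd u π := by
  simp [blockProd]

/-- The finite free cumulants converge to the free cumulants if the moments converge. -/
theorem tendsto_cumulant_of_tendsto_rootMoment
    (hp : ∀ d : ℕ, 1 ≤ d → (p d).Monic ∧ (p d).natDegree = d) {m : ℕ → ℂ}
    (hm : ∀ n : ℕ, 1 ≤ n → Tendsto (fun d : ℕ => rootMoment (p d) n) atTop (𝓝 (m n))) (n : ℕ) :
    Tendsto (fun d : ℕ =>
      PowerSeries.coeff n (scaledLogDeriv (-d : ℂ) (cumulantSeries d (p d)))) atTop
      (𝓝 (freeCumulant m (n + 1))) := by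
  obtain ⟨x, y, hxy, hx, h⟩ := exists_isTreeSystem (freeCumulant m) fun _ => 1
  -- The second factor is the unit (x - 1)^d. Its moments are all 1, so the linear coefficient of x
  -- is 1 and the relation between moments and cumulants can be inverted.
  refine tendsto_coeff_scaledLogDeriv_of_hadamard (D := fun d => -d)
    (V := fun d => reverseSeries ((X - C 1) ^ d)) hxy
    eventually_neg_natCast_ne_zero tendsto_inv_neg_natCast ?_ ?_ ?_ ?_ ?_ n
  · filter_upwards [eventually_ge_atTop 1] with d hd
    exact constantCoeff_cumulantSeries d (hp d hd).1
  · exact Eventually.of_forall fun d => constantCoeff_reverseSeries (monic_X_sub_one_pow d).1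
  · intro n
    refine tendsto_const_nhds.congr' ?_
    filter_upwards [eventually_ge_atTop 1] with d hd
    rw [coeff_scaledLogDeriv_reverseSeries hd (monic_X_sub_one_pow d).1 (monic_X_sub_one_pow d).2,
      rootMoment_X_sub_one_pow hd]
  · rw [hx]
    exact one_ne_zero
  · intro n
    -- With v = 1 the Kreweras factor disappears, and the required limit is the moment-cumulant
    -- formula for `m`.
    rw [← h, ← sum_blockProd_kreweras, sum_blockProd_mul_one,
      ← moment_eq_sum_freeCumulant m (Nat.succ_pos n)]
    refine (hm (n + 1) (Nat.succ_pos n)).congr' ?_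
    filter_upwards [eventually_ge_atTop 1] with d hd
    rw [hadamard_cumulantSeries_reverseSeries hd (hp d hd) (monic_X_sub_one_pow d),
      finiteFreeMul_X_sub_one_pow (hp d hd).2.le,
      coeff_scaledLogDeriv_reverseSeries hd (hp d hd).1 (hp d hd).2]

/-- Blocks are nonempty, so the value at index 0 plays no role. -/
theorem blockProd_congr {u v : ℕ → ℂ} (h : ∀ n, 1 ≤ n → u n = v n) {n : ℕ} (π : SetPartition n) :
    blockProd u π = blockProd v π :=
  Finset.prod_congr rfl fun _ hV => h _ (Finset.card_pos.mpr (π.nonempty_of_mem_parts hV))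

end Convergence

end FreeProb

theorem mainTheorem9
    (μ ν : Measure ℂ) [IsProbabilityMeasure μ] [IsProbabilityMeasure ν]
    (hμ : HasFiniteMoments μ) (hν : HasFiniteMoments ν)
    (p q : ℕ → ℂ[X])
    (hp : ∀ d : ℕ, 1 ≤ d → (p d).Monic ∧ (p d).natDegree = d)
    (hq : ∀ d : ℕ, 1 ≤ d → (q d).Monic ∧ (q d).natDegree = d)
    (hpμ : ∀ n : ℕ, 1 ≤ n →
      Tendsto (fun d : ℕ => rootMoment (p d) n) atTop (𝓝 (measureMoment μ n)))
    (hqν : ∀ n : ℕ, 1 ≤ n →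
      Tendsto (fun d : ℕ => rootMoment (q d) n) atTop (𝓝 (measureMoment ν n))) :
    (∀ n : ℕ, 1 ≤ n →
      Tendsto (fun d : ℕ => rootMoment (finiteFreeMul d (p d) (q d)) n) atTop
        (𝓝 (freeMulMoment (measureMoment μ) (measureMoment ν) n))) ∧
    (∀ n : ℕ, 1 ≤ n →
      freeMulMoment (measureMoment μ) (measureMoment ν) n =
        ∑ π ∈ NC n, blockProd (freeCumulant (measureMoment μ)) π *
          blockProd (measureMoment ν) (kreweras π)) ∧
    (∀ ρ : Measure ℂ, IsFreeMulConv μ ν ρ → ∀ n : ℕ, 1 ≤ n →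
      Tendsto (fun d : ℕ => rootMoment (finiteFreeMul d (p d) (q d)) n) atTop
        (𝓝 (measureMoment ρ n))) := by
  have hr : ∀ d : ℕ, 1 ≤ d → (finiteFreeMul d (p d) (q d)).Monic ∧
      (finiteFreeMul d (p d) (q d)).natDegree = d :=
    fun d hd => monic_finiteFreeMul (hp d hd) (hq d hd)
  have hκp := tendsto_cumulant_of_tendsto_rootMoment hp hpμ
  have hκq := tendsto_cumulant_of_tendsto_rootMoment hq hqν
  have hκr := tendsto_cumulant_finiteFreeMul hp hq hκp hκq
  have hlim : ∀ n : ℕ, 1 ≤ n →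
      Tendsto (fun d : ℕ => rootMoment (finiteFreeMul d (p d) (q d)) n) atTop
        (𝓝 (freeMulMoment (measureMoment μ) (measureMoment ν) n)) := by
    intro n hn
    obtain ⟨n, rfl⟩ := Nat.exists_eq_add_of_le' hn
    -- Convolving p ⊠_d q with the unit (x - 1)^d leaves it unchanged and turns the convergence of
    -- its cumulants into convergence of its moments.
    have h := tendsto_rootMoment_finiteFreeMul (q := fun d => (X - C 1) ^ d)
      (u := freeMulCumulant (measureMoment μ) (measureMoment ν)) (v := fun _ => 1) hr
      (fun d _ => monic_X_sub_one_pow d) hκr (fun n => tendsto_const_nhds.congr' (by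
        filter_upwards [eventually_ge_atTop 1] with d hd
        rw [rootMoment_X_sub_one_pow hd])) n
    rw [sum_blockProd_mul_one] at h
    refine h.congr' ?_
    filter_upwards [eventually_ge_atTop 1] with d hd
    rw [finiteFreeMul_X_sub_one_pow (hr d hd).2.le]
  refine ⟨hlim, fun n hn => ?_, fun ρ hρ n hn => ?_⟩
  -- The same moments are computed a second time, from the cumulants of `p` and the moments of `q`;
  -- uniqueness of limits yields the identity without a separate combinatorial argument.
  · refine tendsto_nhds_unique (hlim n hn) ?_
    obtain ⟨n, rfl⟩ := Nat.exists_eq_add_of_le' hn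
    exact tendsto_rootMoment_finiteFreeMul hp hq hκp (fun n => hqν (n + 1) (Nat.succ_pos n)) n
  · have h : measureMoment ρ n = freeMulMoment (measureMoment μ) (measureMoment ν) n := by
      rw [moment_eq_sum_freeCumulant (measureMoment ρ) hn, freeMulMoment]
      exact Finset.sum_congr rfl fun π _ => blockProd_congr hρ.cumulant_eq π
    rw [h]
    exact hlim n hn
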